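/- Let $\mathbb K$ be a commutative ring, $\Phi:\mathrm{Mod}(\mathbb K)\to\mathrm{Mod}(\mathbb K)$ a functor with $\Phi(0)=0$, $A$ a $\mathbb K$-module and $p:F\twoheadrightarrow A$ a presentation of $A$ (an epimorphism from a free module $F$) with relation module $R=\operatorname{Ker}(p)$ and inclusion $\varphi_p:R\to F$. We use the following notation. * $\mathrm{Pres}(A)$ is the full subcategory of $\mathrm{Mod}(\mathbb K)\downarrow A$ on the presentations of $A$; $\mathsf R_A:\mathrm{Pres}(A)\to \mathrm{Mod}(\mathbb K)$ is the functor $\mathsf R_A(p)=\operatorname{Ker}(p)$. $p^\bullet$ is the cosimplicial object of $\mathrm{Pres}(A)$ with $(p^\bullet)^n=p^{\sqcup (n+1)}:F^{\oplus (n+1)}\to A$, $(a_0,\dots,a_n)\mapsto\sum_i p(a_i)$, where an order-preserving map $\theta$ acts by $\alpha_i\mapsto\alpha_{\theta(i)}$ on the coproduct embeddings $\alpha_i$. $\mathsf{Lim}_{(p)}\Phi\mathsf R_A$ is the normalized cochain complex of the cosimplicial module $V=\Phi(\mathsf R_A(p^\bullet))$: its $n$-th component is $\bigcap_{i=0}^{n-1}\operatorname{Ker}(s^i:V^n\to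 V^{n-1})$, and its differential is the restriction of $\sum_i(-1)^id^i$. * The cross effect $\Phi(A_1|\dots|A_n)$ is $\operatorname{Ker}\bigl(\Phi(\bigoplus_{i}A_i)\to\bigoplus_{j}\Phi(\bigoplus_{i\neq j}A_i)\bigr)$; it is a direct summand of $\Phi(\bigoplus_i A_i)$ with complement the sum of the images of the maps $\Phi(\bigoplus_{i\ne j}A_i)\to\Phi(\bigoplus_iA_i)$ induced by the embeddings. * For a homomorphism $\varphi:B\to C$, $C_\Phi(\varphi)$ is the cochain complex with $C_\Phi(\varphi)^n=\Phi(C|\dots|C|B)$ ($n$ copies of $C$, $n\ge 0$) and differential $\sum_{i=0}^{n}(-1)^ih^i_\varphi$. Here $h^i_\varphi:\Phi(C|\dots|C|B)\hookrightarrow\Phi(C^{\oplus n}\oplus B)\xrightarrow{\Phi(\Delta^i_\varphi)}\Phi(C^{\oplus (n+1)}\oplus B)\twoheadrightarrow\Phi(C|\dots|C|C|B)$, where the last map is the projection onto the direct summand, and $\Delta^i_\varphi(c_0,\dots,c_{n-1},b)=(c_0,\dots,c_i,c_i,\dots,c_{n-1},b)$ for $i<n$, $\Delta^n_\varphi(c_0,\dots,c_{n-1},b)=(c_0,\dots,c_{n-1},\varphi(b),b)$.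 The complex $C_\Phi(\varphi)$ is functorial in commutative squares; $C_\Phi(F):=C_\Phi(1_F)$, and $C_\Phi(1_F,\varphi_p):C_\Phi(\varphi_p)\to C_\Phi(F)$ is induced by the commutative square from $\varphi_p:R\to F$ to $1_F:F\to F$ formed by $\varphi_p:R\to F$ and $1_F:F\to F$. Theorem. There are isomorphisms of cochain complexes (extended by zero to negative degrees) $$\mathsf{Lim}_{(p)}\Phi\mathsf R_A\;\cong\;\mathsf{Cone}\bigl(C_\Phi(1_F,\varphi_p):C_\Phi(\varphi_p)\to C_\Phi(F)\bigr)[-1]$$ that are natural in $\Phi$ (with respect to natural transformations between functors vanishing on $0$) and in $p$ (with respect to commutative squares from $p:F\twoheadrightarrow A$ to $p':F'\twoheadrightarrow A'$; in particular with respect to morphisms of $\mathrm{Pres}(A)$). -/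

import Mathlib

open CategoryTheory CategoryTheory.Limits

universe u v

noncomputable section

namespace CrossEffectComplex

variable {K : Type u} [CommRing K]

/-! ### Normalized cochain complex of a cosimplicial module -/

section Normalized

open AlgebraicTopology Simplicial

/-- The `n`-th normalized module: the intersection of the kernels of all codegeneracies
`s^i : V^n → V^(n-1)`. -/
def normalizedSubmodule (V : CosimplicialObject (ModuleCat.{v} K)) (n : ℕ) :
    Submodule K (V.obj ⦋n⦌) :=
  match n with
  | 0 => ⊤
  | m + 1 => ⨅ i : Fin (m + 1), LinearMap.ker (V.σ i).hom

/-- The alternating sum of the cofaces. -/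
def altCoface (V : CosimplicialObject (ModuleCat.{v} K)) (n : ℕ) : V.obj ⦋n⦌ ⟶ V.obj ⦋n + 1⦌ :=
  ∑ i : Fin (n + 2), (-1 : ℤ) ^ (i : ℕ) • V.δ i

theorem codegeneracy_coface_eq_zero (V : CosimplicialObject (ModuleCat.{v} K)) (n : ℕ)
    (x : V.obj ⦋n⦌) (hx : x ∈ normalizedSubmodule V n) (j : Fin (n + 1)) (i : Fin (n + 2))
    (h1 : i ≠ j.castSucc) (h2 : i ≠ j.succ) :
    (V.σ j).hom ((V.δ i).hom x) = 0 := by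
  cases n with
  | zero =>
    exfalso
    have hj : j = 0 := Fin.fin_one_eq_zero j
    subst hj
    fin_cases i
    · exact h1 rfl
    · exact h2 rfl
  | succ m =>
    have hx' : ∀ k, (V.σ k).hom x = 0 := by
      intro k
      have := (Submodule.mem_iInf _).1 hx k
      exact this
    rcases lt_or_gt_of_ne h1 with h | h
    · obtain ⟨k, rfl⟩ : ∃ k : Fin (m + 1), j = k.succ :=
        Fin.exists_succ_eq.2 (by rintro rfl; exact absurd h (by simp)) |>.imp fun _ h => h.symm
      obtain ⟨l, rfl⟩ : ∃ l : Fin (m + 2), i = l.castSucc :=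
        Fin.exists_castSucc_eq.2 (by
          rintro rfl
          exact absurd h (by simp [Fin.lt_def]; omega)) |>.imp fun _ h => h.symm
      have hl : l ≤ k.castSucc := by
        simp only [Fin.lt_def, Fin.le_def, Fin.val_castSucc, Fin.val_succ] at h ⊢
        omega
      have := congrArg (fun f => f.hom x) (V.δ_comp_σ_of_le hl)
      simp only [ModuleCat.hom_comp, LinearMap.comp_apply] at this
      rw [this, hx', map_zero]
    · have h' : j.succ < i := by
        rcases lt_or_gt_of_ne h2 with h' | h'
        · exfalso
          simp only [Fin.lt_def, Fin.val_castSucc, Fin.val_succ] at h h'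
          omega
        · exact h'
      obtain ⟨l, rfl⟩ : ∃ l : Fin (m + 2), i = l.succ :=
        Fin.exists_succ_eq.2 (by rintro rfl; exact absurd h' (by simp)) |>.imp fun _ h => h.symm
      obtain ⟨k, rfl⟩ : ∃ k : Fin (m + 1), j = k.castSucc :=
        Fin.exists_castSucc_eq.2 (by
          rintro rfl
          exact absurd h' (by simp [Fin.lt_def]; omega)) |>.imp fun _ h => h.symm
      have hl : k.castSucc < l := by
        simp only [Fin.lt_def, Fin.val_castSucc, Fin.val_succ] at h' ⊢
        omega
      have := congrArg (fun f => f.hom x) (V.δ_comp_σ_of_gt hl)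
      simp only [ModuleCat.hom_comp, LinearMap.comp_apply] at this
      rw [this, hx', map_zero]

theorem altCoface_apply (V : CosimplicialObject (ModuleCat.{v} K)) (n : ℕ) (x : V.obj ⦋n⦌) :
    (altCoface V n).hom x = ∑ i : Fin (n + 2), (-1 : ℤ) ^ (i : ℕ) • (V.δ i).hom x := by
  simp [altCoface, ModuleCat.hom_sum, LinearMap.sum_apply]

theorem altCoface_mem (V : CosimplicialObject (ModuleCat.{v} K)) (n : ℕ)
    (x : V.obj ⦋n⦌) (hx : x ∈ normalizedSubmodule V n) :
    (altCoface V n).hom x ∈ normalizedSubmodule V (n + 1) := by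
  refine (Submodule.mem_iInf _).2 fun j => ?_
  rw [LinearMap.mem_ker, altCoface_apply, map_sum,
    Finset.sum_eq_add (j.castSucc) (j.succ) (by simp [Fin.ext_iff])]
  · have e1 : (V.σ j).hom ((V.δ j.castSucc).hom x) = x :=
      congrArg (fun f => f.hom x) (V.δ_comp_σ_self (i := j))
    have e2 : (V.σ j).hom ((V.δ j.succ).hom x) = x :=
      congrArg (fun f => f.hom x) (V.δ_comp_σ_succ (i := j))
    rw [map_zsmul, map_zsmul, e1, e2]
    simp [pow_succ]
  · rintro i - ⟨h1, h2⟩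
    rw [map_zsmul, codegeneracy_coface_eq_zero V n x hx j i h1 h2, smul_zero]
  · intro h; exact absurd (Finset.mem_univ _) h
  · intro h; exact absurd (Finset.mem_univ _) h

/-- The differential of the normalized complex: the restriction of the alternating sum of cofaces
to the submodules `⋂ ker s^i`. -/
def normalizedD (V : CosimplicialObject (ModuleCat.{v} K)) (n : ℕ) :
    ModuleCat.of K (normalizedSubmodule V n) ⟶ ModuleCat.of K (normalizedSubmodule V (n + 1)) :=
  ModuleCat.ofHom ((altCoface V n).hom.restrict (altCoface_mem V n))

/-- The normalized cochain complex of a cosimplicial module: the subcomplex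
`⋂ ker s^i` with the alternating sum of cofaces as its differential. -/
def normalizedComplex (V : CosimplicialObject (ModuleCat.{v} K)) :
    CochainComplex (ModuleCat.{v} K) ℕ :=
  CochainComplex.of (fun n => ModuleCat.of K (normalizedSubmodule V n)) (normalizedD V)
    (fun n => by
      ext x
      exact congrArg (fun f => f.hom x.1) (AlternatingCofaceMapComplex.d_squared V n))

theorem normalizedSubmodule_map {V W : CosimplicialObject (ModuleCat.{v} K)} (f : V ⟶ W) (n : ℕ)
    (x : V.obj ⦋n⦌) (hx : x ∈ normalizedSubmodule V n) :
    (f.app ⦋n⦌).hom x ∈ normalizedSubmodule W n := by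
  cases n with
  | zero => trivial
  | succ m =>
    refine (Submodule.mem_iInf _).2 fun j => ?_
    have h1 : (V.σ j).hom x = 0 := (Submodule.mem_iInf _).1 hx j
    have h2 : (W.σ j).hom ((f.app ⦋m + 1⦌).hom x) = (f.app ⦋m⦌).hom ((V.σ j).hom x) :=
      (congrArg (fun g => g.hom x) (f.naturality (SimplexCategory.σ j))).symm
    rw [LinearMap.mem_ker, h2, h1, map_zero]

/-- The components of the map of normalized complexes induced by a cosimplicial map. -/
def normalizedMapX {V W : CosimplicialObject (ModuleCat.{v} K)} (f : V ⟶ W) (n : ℕ) :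
    ModuleCat.of K (normalizedSubmodule V n) ⟶ ModuleCat.of K (normalizedSubmodule W n) :=
  ModuleCat.ofHom ((f.app ⦋n⦌).hom.restrict (normalizedSubmodule_map f n))

theorem altCoface_natural {V W : CosimplicialObject (ModuleCat.{v} K)} (f : V ⟶ W) (n : ℕ)
    (x : V.obj ⦋n⦌) :
    (altCoface W n).hom ((f.app ⦋n⦌).hom x) = (f.app ⦋n + 1⦌).hom ((altCoface V n).hom x) := by
  rw [altCoface_apply, altCoface_apply, map_sum]
  refine Finset.sum_congr rfl fun i _ => ?_
  rw [map_zsmul]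
  congr 1
  exact (congrArg (fun g => g.hom x) (f.naturality (SimplexCategory.δ i))).symm

/-- The map of normalized complexes induced by a map of cosimplicial modules. -/
def normalizedComplexMap {V W : CosimplicialObject (ModuleCat.{v} K)} (f : V ⟶ W) :
    normalizedComplex V ⟶ normalizedComplex W :=
  CochainComplex.ofHom (normalizedMapX f) (fun n => by
    simp only [normalizedComplex, CochainComplex.of_d]
    ext x
    exact altCoface_natural f n x.1)

end Normalized

/-! ### Cross effects -/

section CrossEffect

variable {ι κ : Type} [Fintype ι] [DecidableEq ι] [Fintype κ] [DecidableEq κ]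

/-- The direct sum of a finite family of modules. -/
abbrev dsum {ι : Type} (A : ι → ModuleCat.{v} K) : ModuleCat.{v} K :=
  ModuleCat.of K (∀ i, A i)

theorem hom_dsum_ext {ι : Type} {M : ModuleCat.{v} K} {A : ι → ModuleCat.{v} K} {f g : M ⟶ dsum A}
    (h : ∀ x i, f.hom x i = g.hom x i) : f = g := by
  apply ModuleCat.hom_ext
  apply LinearMap.ext
  intro x
  funext i
  exact h x i

/-- The canonical projection `⊕_i A_i → ⊕_{i ≠ j} A_i`. -/
def pr {ι : Type} (A : ι → ModuleCat.{v} K) (j : ι) :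
    dsum A ⟶ dsum (fun i : {i : ι // i ≠ j} => A i.1) :=
  ModuleCat.ofHom (LinearMap.pi fun i => LinearMap.proj i.1)

/-- The canonical embedding `⊕_{i ≠ j} A_i → ⊕_i A_i`. -/
def em (A : ι → ModuleCat.{v} K) (j : ι) :
    dsum (fun i : {i : ι // i ≠ j} => A i.1) ⟶ dsum A :=
  ModuleCat.ofHom (LinearMap.pi fun i => if h : i ≠ j then
    LinearMap.proj (φ := fun i : {i : ι // i ≠ j} => A i.1) ⟨i, h⟩ else 0)

/-- The endomorphism of `⊕_i A_i` that keeps the coordinates in `S` and kills the others. -/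
def coordProj (A : ι → ModuleCat.{v} K) (S : Finset ι) : dsum A ⟶ dsum A :=
  ModuleCat.ofHom (LinearMap.pi fun i => if i ∈ S then LinearMap.proj i else 0)

variable (Φ Φ' : ModuleCat.{v} K ⥤ ModuleCat.{v} K)

/-- The cross effect `Φ(A_1 | ... | A_n)` of a family indexed by a finite type: the kernel of
`Φ(⊕_i A_i) → ⊕_j Φ(⊕_{i ≠ j} A_i)`. -/
def crossEffect {ι : Type} (A : ι → ModuleCat.{v} K) : Submodule K (Φ.obj (dsum A)) :=
  ⨅ j, LinearMap.ker (Φ.map (pr A j)).hom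

theorem mem_crossEffect {ι : Type} (A : ι → ModuleCat.{v} K) (x : Φ.obj (dsum A)) :
    x ∈ crossEffect Φ A ↔ ∀ j, (Φ.map (pr A j)).hom x = 0 := by
  simp [crossEffect]

theorem coordProj_apply (A : ι → ModuleCat.{v} K) (S : Finset ι) (x : dsum A) (i : ι) :
    (coordProj A S).hom x i = if i ∈ S then x i else 0 := by
  by_cases h : i ∈ S <;> simp [coordProj, h]

theorem coordProj_comp (A : ι → ModuleCat.{v} K) (S T : Finset ι) :
    coordProj A S ≫ coordProj A T = coordProj A (S ∩ T) := by
  refine hom_dsum_ext fun x i => ?_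
  rw [ModuleCat.hom_comp, LinearMap.comp_apply, coordProj_apply, coordProj_apply, coordProj_apply]
  by_cases h : i ∈ S <;> by_cases h' : i ∈ T <;> simp [h, h']

theorem coordProj_univ (A : ι → ModuleCat.{v} K) : coordProj A Finset.univ = 𝟙 _ := by
  refine hom_dsum_ext fun x i => ?_
  rw [coordProj_apply]
  simp

theorem pr_em (A : ι → ModuleCat.{v} K) (j : ι) :
    pr A j ≫ em A j = coordProj A (Finset.univ.erase j) := by
  refine hom_dsum_ext fun x i => ?_
  rw [ModuleCat.hom_comp, LinearMap.comp_apply, coordProj_apply]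
  by_cases h : i = j <;> simp [pr, em, h]

theorem em_pr (A : ι → ModuleCat.{v} K) (j : ι) :
    em A j ≫ pr A j = 𝟙 _ := by
  refine hom_dsum_ext fun x i => ?_
  simp [pr, em, i.2]

/-- `∑_S (-1)^{|Sᶜ|} Φ(e_S)`, as an endomorphism of `Φ(⊕_i A_i)`. -/
def crossProjEnd (A : ι → ModuleCat.{v} K) : Φ.obj (dsum A) →ₗ[K] Φ.obj (dsum A) :=
  ∑ S : Finset ι, (-1 : ℤ) ^ (Sᶜ.card) • (Φ.map (coordProj A S)).hom

theorem crossProjEnd_apply (A : ι → ModuleCat.{v} K) (x : Φ.obj (dsum A)) :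
    crossProjEnd Φ A x =
      ∑ S : Finset ι, (-1 : ℤ) ^ (Sᶜ.card) • (Φ.map (coordProj A S)).hom x := by
  rw [crossProjEnd, LinearMap.sum_apply]
  rfl

/-- Toggling the membership of one index in a finite set. -/
def toggle (j : ι) (S : Finset ι) : Finset ι := if j ∈ S then S.erase j else insert j S

theorem toggle_sign (j : ι) (S : Finset ι) :
    (-1 : ℤ) ^ ((toggle j S)ᶜ.card) = - (-1 : ℤ) ^ (Sᶜ.card) := by
  unfold toggle
  split_ifs with h
  · rw [Finset.compl_erase, Finset.card_insert_of_notMem (by simpa using h), pow_succ]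
    ring
  · rw [Finset.compl_insert, ← Finset.card_erase_add_one (s := Sᶜ) (a := j) (by simpa using h),
      pow_succ]
    ring

theorem toggle_toggle (j : ι) (S : Finset ι) : toggle j (toggle j S) = S := by
  unfold toggle
  by_cases h : j ∈ S
  · simp [h, Finset.insert_erase]
  · simp [h]

theorem toggle_ne (j : ι) (S : Finset ι) : toggle j S ≠ S := by
  unfold toggle
  by_cases h : j ∈ S
  · simp only [h, if_true]
    intro e
    rw [← e] at h
    simp at h
  · simp only [h, if_false]
    intro e
    rw [← e] at h
    simp at h

theorem sum_toggle_eq_zero {M : Type*} [AddCommGroup M] (j : ι) (f : Finset ι → M)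
    (hf : ∀ S, f (toggle j S) = f S) :
    ∑ S : Finset ι, (-1 : ℤ) ^ (Sᶜ.card) • f S = 0 := by
  refine Finset.sum_involution (fun S _ => toggle j S) ?_ ?_ ?_ ?_
  · intro S _
    rw [toggle_sign, hf, neg_smul, add_neg_cancel]
  · intro S _ _
    exact toggle_ne j S
  · intro S _
    exact Finset.mem_univ _
  · intro S _
    exact toggle_toggle j S

theorem crossProjEnd_mem (A : ι → ModuleCat.{v} K) (x : Φ.obj (dsum A)) :
    crossProjEnd Φ A x ∈ crossEffect Φ A := by
  rw [mem_crossEffect]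
  intro j
  rw [crossProjEnd_apply, map_sum]
  simp only [map_zsmul]
  refine sum_toggle_eq_zero j (fun S => (Φ.map (pr A j)).hom ((Φ.map (coordProj A S)).hom x)) ?_
  intro S
  have h : coordProj A (toggle j S) ≫ pr A j = coordProj A S ≫ pr A j := by
    refine hom_dsum_ext fun y i => ?_
    change (coordProj A (toggle j S)).hom y i.1 = (coordProj A S).hom y i.1
    rw [coordProj_apply, coordProj_apply]
    have hi := i.2
    unfold toggle
    by_cases hj : j ∈ S <;> simp [hj, hi]
  have := congrArg (fun f => (Φ.map f).hom x) h
  simpa only [Functor.map_comp, ModuleCat.hom_comp, LinearMap.comp_apply] using this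

/-- The canonical projection of `Φ(⊕_i A_i)` onto its direct summand `Φ(A_1 | ... | A_n)`, that is,
the projection along `∑_j Im Φ(em_j)`, the sum of the cross effects of the proper subfamilies
(see `crossProj_of_mem`, `crossProj_map_em` and `sub_crossProj_mem`). -/
def crossProj (A : ι → ModuleCat.{v} K) : Φ.obj (dsum A) →ₗ[K] crossEffect Φ A :=
  (crossProjEnd Φ A).codRestrict _ (crossProjEnd_mem Φ A)

theorem map_coordProj_of_mem (A : ι → ModuleCat.{v} K) (x : Φ.obj (dsum A))
    (hx : x ∈ crossEffect Φ A) (S : Finset ι) (hS : S ≠ Finset.univ) :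
    (Φ.map (coordProj A S)).hom x = 0 := by
  obtain ⟨j, hj⟩ : ∃ j, j ∉ S := by
    by_contra! h
    exact hS (Finset.eq_univ_iff_forall.2 h)
  have h : coordProj A S = pr A j ≫ em A j ≫ coordProj A S := by
    rw [← Category.assoc, pr_em, coordProj_comp]
    congr 1
    ext i
    simp only [Finset.mem_inter, Finset.mem_erase, Finset.mem_univ, and_true]
    constructor
    · intro hi
      exact ⟨fun e => hj (e ▸ hi), hi⟩
    · exact fun h => h.2
  rw [h, Functor.map_comp, ModuleCat.hom_comp, LinearMap.comp_apply,
    (mem_crossEffect Φ A x).1 hx j, map_zero]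

/-- `crossProj` is the identity on the cross effect. -/
theorem crossProj_of_mem (A : ι → ModuleCat.{v} K) (x : crossEffect Φ A) :
    crossProj Φ A x.1 = x := by
  apply Subtype.ext
  change crossProjEnd Φ A x.1 = x.1
  rw [crossProjEnd_apply, Finset.sum_eq_single Finset.univ]
  · simp [coordProj_univ]
  · intro S _ hS
    rw [map_coordProj_of_mem Φ A x.1 x.2 S hS, smul_zero]
  · intro h
    exact absurd (Finset.mem_univ _) h

theorem crossProj_map_coordProj (A : ι → ModuleCat.{v} K) (T : Finset ι) (hT : T ≠ Finset.univ)
    (x : Φ.obj (dsum A)) : crossProj Φ A ((Φ.map (coordProj A T)).hom x) = 0 := by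
  obtain ⟨j, hj⟩ : ∃ j, j ∉ T := by
    by_contra! h
    exact hT (Finset.eq_univ_iff_forall.2 h)
  apply Subtype.ext
  change crossProjEnd Φ A _ = 0
  rw [crossProjEnd_apply]
  refine sum_toggle_eq_zero j
    (fun S => (Φ.map (coordProj A S)).hom ((Φ.map (coordProj A T)).hom x)) ?_
  intro S
  have h : coordProj A T ≫ coordProj A (toggle j S) = coordProj A T ≫ coordProj A S := by
    rw [coordProj_comp, coordProj_comp]
    congr 1
    ext i
    unfold toggle
    by_cases hjS : j ∈ S
    · simp only [hjS, if_true, Finset.mem_inter, Finset.mem_erase]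
      constructor
      · exact fun h => ⟨h.1, h.2.2⟩
      · exact fun h => ⟨h.1, fun e => hj (e ▸ h.1), h.2⟩
    · simp only [hjS, if_false, Finset.mem_inter, Finset.mem_insert]
      constructor
      · rintro ⟨h1, rfl | h2⟩
        · exact absurd h1 hj
        · exact ⟨h1, h2⟩
      · exact fun h => ⟨h.1, Or.inr h.2⟩
  have := congrArg (fun f => (Φ.map f).hom x) h
  simpa only [Functor.map_comp, ModuleCat.hom_comp, LinearMap.comp_apply] using this

/-- `crossProj` kills the images of the canonical embeddings. -/
theorem crossProj_map_em (A : ι → ModuleCat.{v} K) (j : ι)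
    (y : Φ.obj (dsum (fun i : {i : ι // i ≠ j} => A i.1))) :
    crossProj Φ A ((Φ.map (em A j)).hom y) = 0 := by
  have h : em A j = em A j ≫ coordProj A (Finset.univ.erase j) := by
    rw [← pr_em, ← Category.assoc, em_pr, Category.id_comp]
  rw [h, Functor.map_comp, ModuleCat.hom_comp, LinearMap.comp_apply]
  exact crossProj_map_coordProj Φ A _ (by simp [Finset.erase_eq_self]) _

theorem sub_crossProj_eq (A : ι → ModuleCat.{v} K) (x : Φ.obj (dsum A)) :
    x - (crossProj Φ A x).1 = - ∑ S ∈ Finset.univ.erase (Finset.univ : Finset ι),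
      (-1 : ℤ) ^ (Sᶜ.card) • (Φ.map (coordProj A S)).hom x := by
  change x - crossProjEnd Φ A x = _
  rw [crossProjEnd_apply, ← Finset.add_sum_erase _ _ (Finset.mem_univ Finset.univ)]
  simp [coordProj_univ]

/-- The complementary summand is the sum of the images of the canonical embeddings. -/
theorem sub_crossProj_mem (A : ι → ModuleCat.{v} K) (x : Φ.obj (dsum A)) :
    x - (crossProj Φ A x).1 ∈ ⨆ j, LinearMap.range (Φ.map (em A j)).hom := by
  rw [sub_crossProj_eq]
  refine Submodule.neg_mem _ (Submodule.sum_mem _ fun S hS => ?_)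
  obtain ⟨j, hj⟩ : ∃ j, j ∉ S := by
    by_contra! h
    exact (Finset.mem_erase.1 hS).1 (Finset.eq_univ_iff_forall.2 h)
  refine zsmul_mem (Submodule.mem_iSup_of_mem j ?_) _
  have h : coordProj A S = (coordProj A S ≫ pr A j) ≫ em A j := by
    rw [Category.assoc, pr_em, coordProj_comp]
    congr 1
    ext i
    simp only [Finset.mem_inter, Finset.mem_erase, Finset.mem_univ, and_true]
    exact ⟨fun hi => ⟨hi, fun e => hj (e ▸ hi)⟩, fun h => h.1⟩
  rw [h, Functor.map_comp, ModuleCat.hom_comp, LinearMap.comp_apply]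
  exact ⟨_, rfl⟩

/-- If every coordinate of the source controls some coordinate of the target, then projecting to the
cross effect before applying `Φ(f)` does not change the projection of the result. -/
theorem crossProj_map_crossProj {A : ι → ModuleCat.{v} K} {B : κ → ModuleCat.{v} K}
    (f : dsum A ⟶ dsum B) (hf : ∀ i, ∃ k, ∀ x : dsum A, x i = 0 → f.hom x k = 0)
    (x : Φ.obj (dsum A)) :
    crossProj Φ B ((Φ.map f).hom (crossProj Φ A x).1) = crossProj Φ B ((Φ.map f).hom x) := by
  have key : crossProj Φ B ((Φ.map f).hom (x - (crossProj Φ A x).1)) = 0 := by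
    rw [sub_crossProj_eq, map_neg, map_neg, map_sum, map_sum, neg_eq_zero]
    refine Finset.sum_eq_zero fun S hS => ?_
    rw [map_zsmul, map_zsmul]
    obtain ⟨i, hi⟩ : ∃ i, i ∉ S := by
      by_contra! h
      exact (Finset.mem_erase.1 hS).1 (Finset.eq_univ_iff_forall.2 h)
    obtain ⟨k, hk⟩ := hf i
    have h : coordProj A S ≫ f = (coordProj A S ≫ f) ≫ coordProj B (Finset.univ.erase k) := by
      refine hom_dsum_ext fun y l => ?_
      rw [ModuleCat.hom_comp (coordProj A S ≫ f), LinearMap.comp_apply, coordProj_apply]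
      by_cases hl : l = k
      · subst hl
        simp only [Finset.mem_erase, ne_eq, not_true_eq_false, false_and, if_false]
        rw [ModuleCat.hom_comp, LinearMap.comp_apply]
        exact hk _ (by rw [coordProj_apply, if_neg hi])
      · simp [hl]
    have h2 := congrArg (fun g => (Φ.map g).hom x) h
    simp only [Functor.map_comp, ModuleCat.hom_comp, LinearMap.comp_apply] at h2
    rw [h2, crossProj_map_coordProj Φ B _ (by simp [Finset.erase_eq_self]), smul_zero]
  rw [map_sub, map_sub, sub_eq_zero] at key
  exact key.symm

/-- The direct sum of a finite family of homomorphisms. -/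
def dsumMap {ι : Type} {A B : ι → ModuleCat.{v} K} (f : ∀ i, A i ⟶ B i) : dsum A ⟶ dsum B :=
  ModuleCat.ofHom (LinearMap.pi fun i => (f i).hom ∘ₗ LinearMap.proj i)

variable {Φ Φ'}

theorem crossEffectMap_mem {ι : Type} (τ : Φ ⟶ Φ') {A B : ι → ModuleCat.{v} K}
    (f : ∀ i, A i ⟶ B i) (x : Φ.obj (dsum A)) (hx : x ∈ crossEffect Φ A) :
    (Φ.map (dsumMap f) ≫ τ.app (dsum B)).hom x ∈ crossEffect Φ' B := by
  rw [mem_crossEffect] at hx ⊢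
  intro j
  have h : (Φ.map (dsumMap f) ≫ τ.app (dsum B)) ≫ Φ'.map (pr B j) =
      Φ.map (pr A j) ≫ Φ.map (dsumMap fun i : {i : ι // i ≠ j} => f i.1) ≫ τ.app _ := by
    rw [Category.assoc, ← τ.naturality, ← Functor.map_comp_assoc, ← Functor.map_comp_assoc]
    rfl
  have h2 := congrArg (fun g => g.hom x) h
  simp only [ModuleCat.hom_comp, LinearMap.comp_apply] at h2 ⊢
  rw [h2, hx j, map_zero, map_zero]

/-- Functoriality of the cross effect, in the modules and in the functor `Φ`. -/
def crossEffectMap {ι : Type} (τ : Φ ⟶ Φ') {A B : ι → ModuleCat.{v} K} (f : ∀ i, A i ⟶ B i) :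
    crossEffect Φ A →ₗ[K] crossEffect Φ' B :=
  (Φ.map (dsumMap f) ≫ τ.app (dsum B)).hom.restrict (crossEffectMap_mem τ f)

theorem crossProj_natural (τ : Φ ⟶ Φ') {A B : ι → ModuleCat.{v} K} (f : ∀ i, A i ⟶ B i)
    (x : Φ.obj (dsum A)) :
    crossProj Φ' B ((Φ.map (dsumMap f) ≫ τ.app (dsum B)).hom x) =
      crossEffectMap τ f (crossProj Φ A x) := by
  apply Subtype.ext
  change crossProjEnd Φ' B _ = (Φ.map (dsumMap f) ≫ τ.app (dsum B)).hom (crossProjEnd Φ A x)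
  rw [crossProjEnd_apply, crossProjEnd_apply, map_sum]
  refine Finset.sum_congr rfl fun S _ => ?_
  rw [map_zsmul]
  congr 1
  have h0 : dsumMap f ≫ coordProj B S = coordProj A S ≫ dsumMap f := by
    refine hom_dsum_ext fun y i => ?_
    rw [ModuleCat.hom_comp, LinearMap.comp_apply, coordProj_apply]
    change _ = (f i).hom ((coordProj A S).hom y i)
    rw [coordProj_apply]
    by_cases h : i ∈ S
    · simp only [h, if_true]; rfl
    · simp [h]
  have h : (Φ.map (dsumMap f) ≫ τ.app (dsum B)) ≫ Φ'.map (coordProj B S) =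
      Φ.map (coordProj A S) ≫ Φ.map (dsumMap f) ≫ τ.app _ := by
    rw [Category.assoc, ← τ.naturality, ← Functor.map_comp_assoc, ← Functor.map_comp_assoc, h0]
  exact congrArg (fun g => g.hom x) h

end CrossEffect

/-! ### The cochain complex of cross effects of a homomorphism -/

section CrossComplex

variable {A A' A'' B B' B'' : ModuleCat.{v} K}

/-- The family consisting of `n` copies of `A`, indexed by `some 0, ..., some (n - 1)`, followed by
one copy of `B`, indexed by `none`. Its direct sum is `A^n ⊕ B`. -/
@[reducible]
def mixed (A B : ModuleCat.{v} K) (n : ℕ) (o : Option (Fin n)) : ModuleCat.{v} K :=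
  match o with
  | none => B
  | some _ => A

/-- The `j`-th coordinate in `A` of the map `Δ^i : A^n ⊕ B → A^(n+1) ⊕ B` below. -/
def diagCoord (φ : B ⟶ A) (n : ℕ) (i j : Fin (n + 1)) : dsum (mixed A B n) →ₗ[K] A :=
  if h : (i : ℕ) < n then
    LinearMap.proj (φ := fun o => mixed A B n o) (some (Fin.predAbove ⟨i, h⟩ j))
  else
    Fin.lastCases (motive := fun _ => dsum (mixed A B n) →ₗ[K] A)
      (φ.hom ∘ₗ LinearMap.proj (φ := fun o => mixed A B n o) none)
      (fun k => LinearMap.proj (φ := fun o => mixed A B n o) (some k)) j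

/-- The map `Δ^i : A^n ⊕ B → A^(n+1) ⊕ B`, `0 ≤ i ≤ n`, that repeats the `i`-th coordinate
(counted from `0`) if `i < n`, and sends `(a_0, ..., a_{n-1}, b)` to
`(a_0, ..., a_{n-1}, φ(b), b)` if `i = n`. -/
def diag (φ : B ⟶ A) (n : ℕ) (i : Fin (n + 1)) :
    dsum (mixed A B n) ⟶ dsum (mixed A B (n + 1)) :=
  ModuleCat.ofHom (LinearMap.pi fun o =>
    match o with
    | none => LinearMap.proj (φ := fun o => mixed A B n o) none
    | some j => diagCoord φ n i j)

/-- The sequence `a_0, ..., a_{n-1}, φ(b), φ(b), ...` attached to an element of `A^n ⊕ B`. -/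
def extSeq (φ : B ⟶ A) (n : ℕ) (x : dsum (mixed A B n)) (k : ℕ) : A :=
  if h : k < n then x (some ⟨k, h⟩) else φ.hom (x none)

theorem diag_none (φ : B ⟶ A) (n : ℕ) (i : Fin (n + 1)) (x : dsum (mixed A B n)) :
    (diag φ n i).hom x none = x none := rfl

theorem diag_some (φ : B ⟶ A) (n : ℕ) (i j : Fin (n + 1)) (x : dsum (mixed A B n)) :
    (diag φ n i).hom x (some j) =
      extSeq φ n x (if (j : ℕ) ≤ i then j else j - 1) := by
  change diagCoord φ n i j x = _
  unfold diagCoord extSeq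
  by_cases h : (i : ℕ) < n
  · rw [dif_pos h]
    by_cases hj : (j : ℕ) ≤ i
    · have h1 : ¬ (i < j) := by rw [Fin.lt_def]; omega
      rw [if_pos hj, dif_pos (by omega)]
      have e : Fin.predAbove ⟨(i : ℕ), h⟩ j = ⟨(j : ℕ), by omega⟩ := by
        ext
        simp [Fin.predAbove, h1]
      exact congrArg (fun k : Fin n => show A from x (some k)) e
    · have h1 : i < j := by rw [Fin.lt_def]; omega
      rw [if_neg hj, dif_pos (by omega)]
      have e : Fin.predAbove ⟨(i : ℕ), h⟩ j = ⟨(j : ℕ) - 1, by omega⟩ := by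
        ext
        simp [Fin.predAbove, h1]
      exact congrArg (fun k : Fin n => show A from x (some k)) e
  · rw [dif_neg h]
    have hj : (j : ℕ) ≤ i := by omega
    rw [if_pos hj]
    induction j using Fin.lastCases with
    | last => simp
    | cast k => simp

theorem extSeq_diag (φ : B ⟶ A) (n : ℕ) (i : Fin (n + 1)) (x : dsum (mixed A B n)) (k : ℕ) :
    extSeq φ (n + 1) ((diag φ n i).hom x) k = extSeq φ n x (if k ≤ i then k else k - 1) := by
  by_cases h : k < n + 1
  · rw [extSeq, dif_pos h, diag_some]
  · rw [extSeq, dif_neg h, diag_none, extSeq, dif_neg]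
    split_ifs <;> omega

/-- The cosimplicial identities `Δ^j Δ^i = Δ^i Δ^(j-1)` for `i < j`. -/
theorem diag_comp_diag (φ : B ⟶ A) (n : ℕ) (i j : Fin (n + 1)) (h : i ≤ j) :
    diag φ n i ≫ diag φ (n + 1) j.succ = diag φ n j ≫ diag φ (n + 1) i.castSucc := by
  refine hom_dsum_ext fun x o => ?_
  rw [ModuleCat.hom_comp, ModuleCat.hom_comp, LinearMap.comp_apply, LinearMap.comp_apply]
  cases o with
  | none => rfl
  | some k =>
    rw [diag_some, diag_some, extSeq_diag, extSeq_diag]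
    congr 1
    have h' : (i : ℕ) ≤ j := h
    simp only [Fin.val_succ, Fin.val_castSucc]
    split_ifs <;> omega

theorem diag_controls (φ : B ⟶ A) (n : ℕ) (i : Fin (n + 1)) (o : Option (Fin n)) :
    ∃ o', ∀ x : dsum (mixed A B n), x o = 0 → (diag φ n i).hom x o' = 0 := by
  cases o with
  | none => exact ⟨none, fun x hx => hx⟩
  | some k =>
    by_cases hk : (k : ℕ) ≤ i
    · refine ⟨some k.castSucc, fun x hx => ?_⟩
      rw [diag_some, Fin.val_castSucc, if_pos hk, extSeq, dif_pos k.2]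
      exact hx
    · refine ⟨some k.succ, fun x hx => ?_⟩
      rw [diag_some, Fin.val_succ, if_neg (by omega), extSeq, dif_pos (by simp)]
      exact hx

variable (Φ Φ' Φ'' : ModuleCat.{v} K ⥤ ModuleCat.{v} K)

/-- The map `h^i : Φ(A|...|A|B) → Φ(A|...|A|A|B)` (from `n` to `n + 1` copies of `A`): the
embedding into `Φ(A^n ⊕ B)`, followed by `Φ(Δ^i)` and by the canonical projection. -/
def crossCoface (φ : B ⟶ A) (n : ℕ) (i : Fin (n + 1)) :
    crossEffect Φ (mixed A B n) →ₗ[K] crossEffect Φ (mixed A B (n + 1)) :=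
  crossProj Φ (mixed A B (n + 1)) ∘ₗ (Φ.map (diag φ n i)).hom ∘ₗ
    (crossEffect Φ (mixed A B n)).subtype

theorem crossCoface_comp (φ : B ⟶ A) (n : ℕ) (i j : Fin (n + 1)) (h : i ≤ j)
    (x : crossEffect Φ (mixed A B n)) :
    crossCoface Φ φ (n + 1) j.succ (crossCoface Φ φ n i x) =
      crossCoface Φ φ (n + 1) i.castSucc (crossCoface Φ φ n j x) := by
  change crossProj Φ _ ((Φ.map (diag φ (n + 1) j.succ)).hom
      (crossProj Φ _ ((Φ.map (diag φ n i)).hom x.1)).1) =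
    crossProj Φ _ ((Φ.map (diag φ (n + 1) i.castSucc)).hom
      (crossProj Φ _ ((Φ.map (diag φ n j)).hom x.1)).1)
  rw [crossProj_map_crossProj Φ _ (diag_controls φ (n + 1) _),
    crossProj_map_crossProj Φ _ (diag_controls φ (n + 1) _)]
  congr 1
  have := congrArg (fun f => (Φ.map f).hom x.1) (diag_comp_diag φ n i j h)
  simpa only [Functor.map_comp, ModuleCat.hom_comp, LinearMap.comp_apply] using this

/-- The differential `∑ (-1)^i h^i` of the complex of cross effects. -/
def crossD (φ : B ⟶ A) (n : ℕ) :
    ModuleCat.of K (crossEffect Φ (mixed A B n)) ⟶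
      ModuleCat.of K (crossEffect Φ (mixed A B (n + 1))) :=
  ModuleCat.ofHom (∑ i : Fin (n + 1), (-1 : ℤ) ^ (i : ℕ) • crossCoface Φ φ n i)

theorem crossD_apply (φ : B ⟶ A) (n : ℕ) (x : crossEffect Φ (mixed A B n)) :
    (crossD Φ φ n).hom x = ∑ i : Fin (n + 1), (-1 : ℤ) ^ (i : ℕ) • crossCoface Φ φ n i x := by
  change (∑ i : Fin (n + 1), (-1 : ℤ) ^ (i : ℕ) • crossCoface Φ φ n i) x = _
  rw [LinearMap.sum_apply]
  rfl

theorem crossD_crossD (φ : B ⟶ A) (n : ℕ) (x : crossEffect Φ (mixed A B n)) :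
    (crossD Φ φ (n + 1)).hom ((crossD Φ φ n).hom x) = 0 := by
  rw [crossD_apply, crossD_apply]
  simp only [map_sum, map_zsmul, Finset.smul_sum, smul_smul]
  rw [← Finset.sum_product']
  refine Finset.sum_involution
    (fun (p : Fin (n + 2) × Fin (n + 1)) _ =>
      if h : (p.2 : ℕ) < p.1 then
        ((⟨p.2, by omega⟩ : Fin (n + 2)), (⟨(p.1 : ℕ) - 1, by omega⟩ : Fin (n + 1)))
      else ((⟨(p.2 : ℕ) + 1, by omega⟩ : Fin (n + 2)), (⟨p.1, by omega⟩ : Fin (n + 1))))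
    ?_ ?_ ?_ ?_
  · rintro ⟨j, i⟩ -
    dsimp only
    split_ifs with h
    · obtain ⟨k, rfl⟩ : ∃ k : Fin (n + 1), k.succ = j :=
        Fin.exists_succ_eq.2 (by rintro rfl; simp at h)
      have hik : i ≤ k := by
        simp only [Fin.val_succ] at h
        exact Fin.le_def.2 (by omega)
      have := crossCoface_comp Φ φ n i k hik x
      rw [this]
      have e : (⟨(k.succ : ℕ) - 1, by simp; omega⟩ : Fin (n + 1)) = k := by ext; simp
      have e' : (⟨(i : ℕ), by omega⟩ : Fin (n + 2)) = i.castSucc := rfl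
      rw [e, e', ← add_smul]
      have hz : (-1 : ℤ) ^ (k.succ : ℕ) * (-1) ^ (i : ℕ) +
          (-1) ^ (i.castSucc : ℕ) * (-1) ^ (k : ℕ) = 0 := by
        simp only [Fin.val_succ, Fin.val_castSucc, pow_succ]; ring
      rw [hz, zero_smul]
    · have hji : (j : ℕ) ≤ i := by omega
      have hik : (⟨(j : ℕ), by omega⟩ : Fin (n + 1)) ≤ i := hji
      have := crossCoface_comp Φ φ n _ i hik x
      have e : (⟨(i : ℕ) + 1, by omega⟩ : Fin (n + 2)) = i.succ := rfl
      have e' : j = (⟨(j : ℕ), by omega⟩ : Fin (n + 1)).castSucc := rfl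
      rw [e, this, ← e', ← add_smul]
      have hz : (-1 : ℤ) ^ (j : ℕ) * (-1) ^ (i : ℕ) +
          (-1) ^ (i.succ : ℕ) * (-1) ^ (j : ℕ) = 0 := by
        simp only [Fin.val_succ, pow_succ]; ring
      rw [hz, zero_smul]
  · rintro ⟨j, i⟩ - -
    dsimp only
    split_ifs with h
    · intro e
      have := congrArg (fun p => (p.1 : ℕ)) e
      dsimp only at this
      omega
    · intro e
      have := congrArg (fun p => (p.1 : ℕ)) e
      dsimp only at this
      omega
  · intro _ _
    exact Finset.mem_product.2 ⟨Finset.mem_univ _, Finset.mem_univ _⟩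
  · rintro ⟨j, i⟩ -
    dsimp only
    by_cases h : (i : ℕ) < j
    · have h2 : ¬ ((j : ℕ) - 1 < i) := by omega
      simp only [h, dif_pos, h2, dif_neg, not_false_eq_true]
      ext <;> simp
      omega
    · have h2 : (j : ℕ) < i + 1 := by omega
      simp only [h, dif_pos, h2, dif_neg, not_false_eq_true]
      ext <;> simp

/-- The cochain complex `C_Φ(φ)` of cross effects attached to `φ : B → A`:
`Φ(B) → Φ(A|B) → Φ(A|A|B) → ...`. -/
def crossComplex (φ : B ⟶ A) : CochainComplex (ModuleCat.{v} K) ℕ :=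
  CochainComplex.of (fun n => ModuleCat.of K (crossEffect Φ (mixed A B n))) (crossD Φ φ)
    (fun n => by
      apply ModuleCat.hom_ext
      apply LinearMap.ext
      intro x
      exact crossD_crossD Φ φ n x)

/-- The family of homomorphisms consisting of `n` copies of `β : A → A'` and of `α : B → B'`. -/
def mixedMap (α : B ⟶ B') (β : A ⟶ A') (n : ℕ) (o : Option (Fin n)) :
    mixed A B n o ⟶ mixed A' B' n o :=
  match o with
  | none => α
  | some _ => β

variable {Φ Φ' Φ''}

/-- The map `Φ(A|...|A|B) → Φ'(A'|...|A'|B')` induced by `τ : Φ → Φ'`, `α : B → B'` and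
`β : A → A'`. -/
def crossMapX (τ : Φ ⟶ Φ') (α : B ⟶ B') (β : A ⟶ A') (n : ℕ) :
    ModuleCat.of K (crossEffect Φ (mixed A B n)) ⟶
      ModuleCat.of K (crossEffect Φ' (mixed A' B' n)) :=
  ModuleCat.ofHom (crossEffectMap τ (mixedMap α β n))

theorem extSeq_map {φ : B ⟶ A} {ψ : B' ⟶ A'} (α : B ⟶ B') (β : A ⟶ A') (w : φ ≫ β = α ≫ ψ)
    (n : ℕ) (x : dsum (mixed A B n)) (k : ℕ) :
    extSeq ψ n ((dsumMap (mixedMap α β n)).hom x) k = β.hom (extSeq φ n x k) := by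
  unfold extSeq
  split_ifs with h
  · rfl
  · exact (congrArg (fun f => f.hom (x none)) w).symm

theorem diag_natural {φ : B ⟶ A} {ψ : B' ⟶ A'} (α : B ⟶ B') (β : A ⟶ A') (w : φ ≫ β = α ≫ ψ)
    (n : ℕ) (i : Fin (n + 1)) :
    dsumMap (mixedMap α β n) ≫ diag ψ n i = diag φ n i ≫ dsumMap (mixedMap α β (n + 1)) := by
  refine hom_dsum_ext fun x o => ?_
  rw [ModuleCat.hom_comp, ModuleCat.hom_comp, LinearMap.comp_apply, LinearMap.comp_apply]
  cases o with
  | none => rfl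
  | some k =>
    rw [diag_some, extSeq_map α β w]
    change _ = β.hom ((diag φ n i).hom x (some k))
    rw [diag_some]

theorem crossCoface_natural (τ : Φ ⟶ Φ') {φ : B ⟶ A} {ψ : B' ⟶ A'} (α : B ⟶ B') (β : A ⟶ A')
    (w : φ ≫ β = α ≫ ψ) (n : ℕ) (i : Fin (n + 1)) (x : crossEffect Φ (mixed A B n)) :
    crossCoface Φ' ψ n i (crossEffectMap τ (mixedMap α β n) x) =
      crossEffectMap τ (mixedMap α β (n + 1)) (crossCoface Φ φ n i x) := by
  change crossProj Φ' _ ((Φ'.map (diag ψ n i)).hom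
    ((Φ.map (dsumMap (mixedMap α β n)) ≫ τ.app _).hom x.1)) =
    crossEffectMap τ (mixedMap α β (n + 1)) (crossProj Φ _ ((Φ.map (diag φ n i)).hom x.1))
  rw [← crossProj_natural]
  congr 1
  have h : (Φ.map (dsumMap (mixedMap α β n)) ≫ τ.app _) ≫ Φ'.map (diag ψ n i) =
      Φ.map (diag φ n i) ≫ Φ.map (dsumMap (mixedMap α β (n + 1))) ≫ τ.app _ := by
    rw [Category.assoc, ← τ.naturality, ← Functor.map_comp_assoc, ← Functor.map_comp_assoc,
      diag_natural α β w]
  exact congrArg (fun g => g.hom x.1) h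

/-- The morphism `C_Φ(φ) → C_Φ'(ψ)` induced by a natural transformation `τ : Φ → Φ'` and a
commutative square formed by `φ : B → A`, `ψ : B' → A'`, `α : B → B'`, `β : A → A'`. -/
def crossComplexMap (τ : Φ ⟶ Φ') {φ : B ⟶ A} {ψ : B' ⟶ A'} (α : B ⟶ B') (β : A ⟶ A')
    (w : φ ≫ β = α ≫ ψ) : crossComplex Φ φ ⟶ crossComplex Φ' ψ :=
  CochainComplex.ofHom (crossMapX τ α β) (fun n => by
    simp only [crossComplex, CochainComplex.of_d]
    apply ModuleCat.hom_ext
    apply LinearMap.ext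
    intro x
    change (crossD Φ' ψ n).hom (crossEffectMap τ (mixedMap α β n) x) =
      crossEffectMap τ (mixedMap α β (n + 1)) ((crossD Φ φ n).hom x)
    rw [crossD_apply, crossD_apply, map_sum]
    refine Finset.sum_congr rfl fun i _ => ?_
    rw [map_zsmul, crossCoface_natural τ α β w])

theorem crossComplexMap_comp (τ : Φ ⟶ Φ') (τ' : Φ' ⟶ Φ'') {φ : B ⟶ A} {φ' : B' ⟶ A'}
    {φ'' : B'' ⟶ A''} (α : B ⟶ B') (β : A ⟶ A') (w : φ ≫ β = α ≫ φ') (α' : B' ⟶ B'')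
    (β' : A' ⟶ A'') (w' : φ' ≫ β' = α' ≫ φ'') (w'' : φ ≫ β ≫ β' = (α ≫ α') ≫ φ'') :
    crossComplexMap τ α β w ≫ crossComplexMap τ' α' β' w' =
      crossComplexMap (τ ≫ τ') (α ≫ α') (β ≫ β') w'' := by
  ext n x
  apply Subtype.ext
  have h : (Φ.map (dsumMap (mixedMap α β n)) ≫ τ.app _) ≫
      Φ'.map (dsumMap (mixedMap α' β' n)) ≫ τ'.app _ =
      Φ.map (dsumMap (mixedMap (α ≫ α') (β ≫ β') n)) ≫ (τ ≫ τ').app _ := by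
    have h0 : dsumMap (mixedMap (α ≫ α') (β ≫ β') n) =
        dsumMap (mixedMap α β n) ≫ dsumMap (mixedMap α' β' n) := by
      refine hom_dsum_ext fun x o => ?_
      cases o <;> rfl
    rw [h0, Functor.map_comp]
    simp
  exact congrArg (fun g => g.hom x.1) h

end CrossComplex

/-! ### The standard complex for higher limits -/

section Standard

open Simplicial

/-- The cosimplicial object `c^•` with `(c^•)^n = c ⊔ ... ⊔ c` (`n + 1` copies), for given
coproducts `t n` of `n + 1` copies of `c`. A nondecreasing map `θ` acts by `α_i ↦ α_{θ(i)}`; so the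
cofaces omit one of the embeddings `α_i`, and the codegeneracies repeat one of them. -/
def copowers {C : Type*} [Category C] (c : C) (t : ∀ n : ℕ, Cofan (fun _ : Fin (n + 1) => c))
    (ht : ∀ n, IsColimit (t n)) : CosimplicialObject C where
  obj m := (t m.len).pt
  map {m _} θ := Cofan.IsColimit.desc (ht m.len) fun i => (t _).inj (θ.toOrderHom i)
  map_id m := Cofan.IsColimit.hom_ext (ht m.len) _ _ fun i => by simp
  map_comp {m _ _} θ η := Cofan.IsColimit.hom_ext (ht m.len) _ _ fun i => by simp

/-- The complex `Lim_{(c)} Ψ = N(Ψ(c^•))`. -/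
def standardComplex {C : Type*} [Category C] (Ψ : C ⥤ ModuleCat.{v} K) (c : C)
    (t : ∀ n : ℕ, Cofan (fun _ : Fin (n + 1) => c)) (ht : ∀ n, IsColimit (t n)) :
    CochainComplex (ModuleCat.{v} K) ℕ :=
  normalizedComplex (((CosimplicialObject.whiskering _ _).obj Ψ).obj (copowers c t ht))

end Standard

/-! ### Presentations and the relation functor -/

section Presentations

open Simplicial

/-- An object `p : F → A` over `A` is a presentation if `F` is free and `p` is surjective. -/
def isPresentation (A : ModuleCat.{v} K) : ObjectProperty (Over A) :=
  fun p => Module.Free K p.left ∧ Function.Surjective p.hom.hom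

/-- The category of presentations of `A`. -/
abbrev Pres (A : ModuleCat.{v} K) := (isPresentation A).FullSubcategory

variable {A A' : ModuleCat.{v} K}

/-- The free module `F` of a presentation `p : F → A`. -/
abbrev Pres.F (p : Pres A) : ModuleCat.{v} K := p.obj.left

/-- The epimorphism `F → A` of a presentation. -/
abbrev Pres.π (p : Pres A) : p.F ⟶ A := p.obj.hom

/-- The relation module `R = Ker(p)`. -/
abbrev Pres.R (p : Pres A) : ModuleCat.{v} K := ModuleCat.of K (LinearMap.ker p.π.hom)

/-- The embedding `φ_p : R → F` of the kernel. -/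
def Pres.φ (p : Pres A) : p.R ⟶ p.F := ModuleCat.ofHom (LinearMap.ker p.π.hom).subtype

/-- A commutative square from `p : F → A` to `p' : F' → A'`. -/
structure Square (p : Pres A) (p' : Pres A') where
  /-- the map of the free modules -/
  top : p.F ⟶ p'.F
  /-- the map of the presented modules -/
  base : A ⟶ A'
  w : top ≫ p'.π = p.π ≫ base

theorem Square.map_mem_ker {p : Pres A} {p' : Pres A'} (s : Square p p') (x : p.F)
    (hx : x ∈ LinearMap.ker p.π.hom) : s.top.hom x ∈ LinearMap.ker p'.π.hom := by
  have h := congrArg (fun f => f.hom x) s.w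
  simp only [ModuleCat.hom_comp, LinearMap.comp_apply] at h
  rw [LinearMap.mem_ker] at hx ⊢
  rw [h, hx, map_zero]

/-- The map of relation modules induced by a commutative square. -/
def Square.rel {p : Pres A} {p' : Pres A'} (s : Square p p') : p.R ⟶ p'.R :=
  ModuleCat.ofHom (s.top.hom.restrict s.map_mem_ker)

theorem Square.φ_top {p : Pres A} {p' : Pres A'} (s : Square p p') :
    p.φ ≫ s.top = s.rel ≫ p'.φ := rfl

/-- The square over the identity of `A` given by a morphism of presentations of `A`. -/
def Square.ofHom {p p' : Pres A} (f : p ⟶ p') : Square p p' where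
  top := f.hom.left
  base := 𝟙 A
  w := by simp

/-- The relation functor `R_A : Pres(A) → Mod(K)`, `p ↦ Ker(p)`. -/
def relationFunctor (A : ModuleCat.{v} K) : Pres A ⥤ ModuleCat.{v} K where
  obj p := p.R
  map f := (Square.ofHom f).rel

/-- The presentation `p ⊔ ... ⊔ p : F^(n+1) → A`, `(a_0, ..., a_n) ↦ ∑ p(a_i)`. -/
def Pres.pow (p : Pres A) (n : ℕ) : Pres A where
  obj := Over.mk (Y := ModuleCat.of K (Fin (n + 1) → p.F))
    (ModuleCat.ofHom (∑ i : Fin (n + 1), p.π.hom ∘ₗ LinearMap.proj i))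
  property := by
    have := p.property.1
    refine ⟨inferInstanceAs (Module.Free K (Fin (n + 1) → p.F)), fun a => ?_⟩
    obtain ⟨x, hx⟩ := p.property.2 a
    refine ⟨(Pi.single 0 x : Fin (n + 1) → p.F), ?_⟩
    change (∑ i : Fin (n + 1), p.π.hom ∘ₗ LinearMap.proj i) (Pi.single 0 x : Fin (n + 1) → p.F) = a
    rw [LinearMap.sum_apply, Finset.sum_eq_single 0]
    · simpa using hx
    · intro i _ hi
      simp [hi]
    · intro h
      exact absurd (Finset.mem_univ _) h

theorem Pres.pow_π_apply (p : Pres A) (n : ℕ) (x : Fin (n + 1) → p.F) :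
    (p.pow n).π.hom x = ∑ i, p.π.hom (x i) := by
  change (∑ i : Fin (n + 1), p.π.hom ∘ₗ LinearMap.proj i) x = _
  rw [LinearMap.sum_apply]
  rfl

/-- The embeddings `α_i : p → p ⊔ ... ⊔ p`. -/
def Pres.powι (p : Pres A) (n : ℕ) (i : Fin (n + 1)) : p ⟶ p.pow n :=
  ObjectProperty.homMk (Over.homMk
    (ModuleCat.ofHom (LinearMap.single K (fun _ : Fin (n + 1) => (p.F : Type v)) i))
    (by
      apply ModuleCat.hom_ext
      apply LinearMap.ext
      intro x
      change (p.pow n).π.hom (Pi.single i x : Fin (n + 1) → p.F) = p.π.hom x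
      rw [Pres.pow_π_apply, Finset.sum_eq_single i]
      · simp
      · intro j _ hj
        simp [hj]
      · intro h
        exact absurd (Finset.mem_univ _) h))

/-- The cofan `p ⊔ ... ⊔ p` in the category of presentations of `A`. -/
def Pres.powCofan (p : Pres A) (n : ℕ) : Cofan (fun _ : Fin (n + 1) => p) :=
  Cofan.mk (p.pow n) (p.powι n)

/-- The morphism `(f_0, ..., f_n) : p ⊔ ... ⊔ p → q`. -/
def Pres.powDesc {p q : Pres A} (n : ℕ) (f : Fin (n + 1) → (p ⟶ q)) : p.pow n ⟶ q :=
  ObjectProperty.homMk (Over.homMk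
    (ModuleCat.ofHom (∑ i : Fin (n + 1), (f i).hom.left.hom ∘ₗ LinearMap.proj i))
    (by
      apply ModuleCat.hom_ext
      apply LinearMap.ext
      intro (x : Fin (n + 1) → p.F)
      change q.π.hom ((∑ i : Fin (n + 1), (f i).hom.left.hom ∘ₗ LinearMap.proj i) x) =
        (p.pow n).π.hom x
      rw [Pres.pow_π_apply, LinearMap.sum_apply, map_sum]
      refine Finset.sum_congr rfl fun i _ => ?_
      exact congrArg (fun g => g.hom (x i)) (Over.w (f i).hom)))

theorem Pres.powDesc_apply {p q : Pres A} (n : ℕ) (f : Fin (n + 1) → (p ⟶ q))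
    (x : Fin (n + 1) → p.F) :
    (Pres.powDesc n f).hom.left.hom x = ∑ i, (f i).hom.left.hom (x i) := by
  change (∑ i : Fin (n + 1), (f i).hom.left.hom ∘ₗ LinearMap.proj i) x = _
  rw [LinearMap.sum_apply]
  rfl

theorem Pres.hom_ext_apply {p q : Pres A} {f g : p ⟶ q}
    (h : ∀ x, f.hom.left.hom x = g.hom.left.hom x) : f = g := by
  apply ObjectProperty.hom_ext
  apply Over.OverMorphism.ext
  apply ModuleCat.hom_ext
  apply LinearMap.ext
  exact h

/-- `p ⊔ ... ⊔ p : F^(n+1) → A` is the coproduct of `n + 1` copies of `p` in the category of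
presentations of `A`. -/
def Pres.powIsColimit (p : Pres A) (n : ℕ) : IsColimit (p.powCofan n) :=
  Cofan.IsColimit.mk _ (fun t => Pres.powDesc n t.inj)
    (fun t j => Pres.hom_ext_apply fun x => by
      change (Pres.powDesc n t.inj).hom.left.hom (Pi.single j x : Fin (n + 1) → p.F) = _
      rw [Pres.powDesc_apply, Finset.sum_eq_single j]
      · simp
      · intro i _ hi
        simp [hi]
      · intro h
        exact absurd (Finset.mem_univ _) h)
    (fun t m hm => Pres.hom_ext_apply fun (x : Fin (n + 1) → p.F) => by
      refine Eq.trans ?_ (Pres.powDesc_apply n t.inj x).symm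
      have hx : x = ∑ i, (Pi.single i (x i) : Fin (n + 1) → p.F) :=
        (Finset.univ_sum_single x).symm
      have hm' : m.hom.left.hom x = ∑ i,
          (show (Fin (n + 1) → p.F) →ₗ[K] t.pt.F from m.hom.left.hom) (Pi.single i (x i)) := by
        conv_lhs => rw [hx]
        exact map_sum (show (Fin (n + 1) → p.F) →ₗ[K] t.pt.F from m.hom.left.hom) _ _
      refine hm'.trans (Finset.sum_congr rfl fun i _ => ?_)
      rw [← hm i]
      rfl)

/-- The complex `Lim_{(p)} (Φ R_A)`. -/
def limComplex (Φ : ModuleCat.{v} K ⥤ ModuleCat.{v} K) (p : Pres A) :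
    CochainComplex (ModuleCat.{v} K) ℕ :=
  standardComplex (relationFunctor A ⋙ Φ) p p.powCofan p.powIsColimit

/-- The square between the powers of `p` and of `p'` that is induced by a square from `p` to `p'`,
given by `(a_0, ..., a_n) ↦ (f(a_0), ..., f(a_n))`. -/
def Square.pow {p : Pres A} {p' : Pres A'} (s : Square p p') (n : ℕ) :
    Square (p.pow n) (p'.pow n) where
  top := ModuleCat.ofHom (LinearMap.pi fun i => s.top.hom ∘ₗ
    LinearMap.proj (φ := fun _ : Fin (n + 1) => (p.F : Type v)) i)
  base := s.base
  w := by
    apply ModuleCat.hom_ext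
    apply LinearMap.ext
    intro (x : Fin (n + 1) → p.F)
    change (p'.pow n).π.hom (fun i => s.top.hom (x i)) = s.base.hom ((p.pow n).π.hom x)
    rw [Pres.pow_π_apply, Pres.pow_π_apply, map_sum]
    refine Finset.sum_congr rfl fun i _ => ?_
    exact congrArg (fun g => g.hom (x i)) s.w

/-- The map of cosimplicial modules `R_A(p^•) → R_{A'}(p'^•)` induced by a square. -/
def Square.relCopowers {p : Pres A} {p' : Pres A'} (s : Square p p') :
    ((CosimplicialObject.whiskering _ _).obj (relationFunctor A)).obj
        (copowers p p.powCofan p.powIsColimit) ⟶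
      ((CosimplicialObject.whiskering _ _).obj (relationFunctor A')).obj
        (copowers p' p'.powCofan p'.powIsColimit) where
  app m := (s.pow m.len).rel
  naturality m m' θ := by
    apply ModuleCat.hom_ext
    apply LinearMap.ext
    intro x
    apply Subtype.ext
    obtain ⟨(x : Fin (m.len + 1) → p.F), hx⟩ := x
    change (s.pow m'.len).top.hom ((Pres.powDesc m.len
      (fun i => p.powι m'.len (θ.toOrderHom i))).hom.left.hom x) =
      (Pres.powDesc m.len (fun i => p'.powι m'.len (θ.toOrderHom i))).hom.left.hom
        (fun i => s.top.hom (x i))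
    rw [Pres.powDesc_apply, Pres.powDesc_apply, map_sum]
    refine Finset.sum_congr rfl fun i _ => ?_
    change (fun j => s.top.hom ((Pi.single (θ.toOrderHom i) (x i) : Fin (m'.len + 1) → p.F) j)) =
      (Pi.single (θ.toOrderHom i) (s.top.hom (x i)) : Fin (m'.len + 1) → p'.F)
    funext j
    by_cases hj : j = θ.toOrderHom i
    · subst hj; simp
    · simp [hj]

/-- The map `Lim_{(p)} (Φ R_A) → Lim_{(p')} (Φ' R_{A'})` induced by a natural transformation
`Φ → Φ'` and a square from `p` to `p'`. -/
def limComplexMap {Φ Φ' : ModuleCat.{v} K ⥤ ModuleCat.{v} K} (τ : Φ ⟶ Φ')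
    {p : Pres A} {p' : Pres A'} (s : Square p p') : limComplex Φ p ⟶ limComplex Φ' p' :=
  normalizedComplexMap
    (((CosimplicialObject.whiskering _ _).obj Φ).map s.relCopowers ≫
      Functor.whiskerLeft _ τ)

end Presentations

/-! ### The shifted cone -/

section Cone

open ComplexShape

variable {A A' : ModuleCat.{v} K}

/-- The morphism `C_Φ(1_F, φ_p) : C_Φ(φ_p) → C_Φ(F) = C_Φ(1_F)`, where the complexes are extended by
zero to negative degrees. -/
def coneInput (Φ : ModuleCat.{v} K ⥤ ModuleCat.{v} K) (p : Pres A) :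
    (crossComplex Φ p.φ).extend embeddingUpNat ⟶ (crossComplex Φ (𝟙 p.F)).extend embeddingUpNat :=
  HomologicalComplex.extendMap (crossComplexMap (𝟙 Φ) p.φ (𝟙 p.F) rfl) embeddingUpNat

/-- The complex `Cone(C_Φ(1_F, φ_p) : C_Φ(φ_p) → C_Φ(F))[-1]`. -/
def shiftedCone (Φ : ModuleCat.{v} K ⥤ ModuleCat.{v} K) (p : Pres A) :
    CochainComplex (ModuleCat.{v} K) ℤ :=
  (CochainComplex.mappingCone (coneInput Φ p))⟦(-1 : ℤ)⟧

theorem coneInput_natural {Φ Φ' : ModuleCat.{v} K ⥤ ModuleCat.{v} K} (τ : Φ ⟶ Φ')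
    {p : Pres A} {p' : Pres A'} (s : Square p p') :
    coneInput Φ p ≫ HomologicalComplex.extendMap
        (crossComplexMap τ s.top s.top (by simp)) embeddingUpNat =
      HomologicalComplex.extendMap
        (crossComplexMap τ s.rel s.top s.φ_top) embeddingUpNat ≫ coneInput Φ' p' := by
  unfold coneInput
  rw [← HomologicalComplex.extendMap_comp, ← HomologicalComplex.extendMap_comp,
    crossComplexMap_comp (w'' := by simp), crossComplexMap_comp (w'' := by simp [s.φ_top])]
  congr 1

/-- The map of shifted cones induced by a natural transformation `Φ → Φ'` and a square from `p` to
`p'`. -/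
def shiftedConeMap {Φ Φ' : ModuleCat.{v} K ⥤ ModuleCat.{v} K} (τ : Φ ⟶ Φ')
    {p : Pres A} {p' : Pres A'} (s : Square p p') : shiftedCone Φ p ⟶ shiftedCone Φ' p' :=
  (CochainComplex.mappingCone.map _ _ _ _ (coneInput_natural τ s))⟦(-1 : ℤ)⟧'

end Cone

end CrossEffectComplex

end

namespace CrossEffectComplex

noncomputable section

variable {K : Type u} [CommRing K]

/-! ### Morphisms to a shifted mapping cone -/

section ShiftedCone

open CochainComplex CochainComplex.HomComplex CochainComplex.mappingCone ComplexShape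

variable {C : Type*} [Category* C] [Preadditive C] [HasBinaryBiproducts C]

variable {L P Q L' P' Q' : CochainComplex C ℤ}

/-! Partial sums straighten the cosimplicial module. A relation for the power of `p` is a tuple
(a_0, ..., a_n) whose total lies in R, and (a_0, ..., a_n) ↦ (a_0, a_0 + a_1, ..., a_0 + ... + a_n)
identifies the module of these relations with F^n ⊕ R (`Pres.relCoord_bijective`). Read as a
sequence in F whose last entry comes from R, such an element behaves as follows: the coface d^(i+1)
is Δ^i (`Pres.δ_succ_relCoord`), the coface d^0 inserts a zero in front (`Pres.extSeq_δ_zero`), and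
the codegeneracy s^i forgets the i-th coordinate, which is always one of the copies of F
(`Pres.extSeq_σ`).

Hence N^n is the part of Φ(F^n ⊕ R) killed by forgetting any one copy of F
(`mem_normalizedSubmodule_iff`). The idempotent that kills R splits it as Φ(F|...|F|R) ⊕ Φ(F|...|F),
with n copies of F in each summand. The second summand is C_Φ(F)^(n-1) when n > 0. For n = 0 it
would be Φ(0) = 0, which is where the hypothesis on Φ enters (`ofCrossRel_toCrossRel_add`,
`ofCrossRel_toCrossRel_zero`).

For the differential, d^0 has a zero coordinate and so vanishes in every cross effect concerned; the
other cofaces contribute -∑ (-1)^i Δ^i (`crossProj_altCoface`). On the summand with R this is minus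
the differential of C_Φ(φ_p). After forgetting R, the Δ^i with i < n become those of the identity of
F, giving minus the differential of C_Φ(F), while Δ^n becomes the map induced by φ_p and gives
-(-1)^n C_Φ(1_F, φ_p). Multiplying the first component by (-1)^n makes it a chain map a, and the
second component b then satisfies b d = -f a - d b, which is what a map to the shifted cone requires
(`coneLift`). Partial sums and projections to cross effects are natural, hence so is the
isomorphism. -/

/-- The degree `p` part of the map to the shifted cone with given components. -/
def coneLiftX (f : P ⟶ Q) (a : L ⟶ P) (b : Cochain L Q (-1)) (p q : ℤ) (h : p + -1 = q) :
    L.X p ⟶ (mappingCone f).X q :=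
  a.f p ≫ (inl f).v p q h + b.v p q h ≫ (inr f).f q

/-- The shift by -1 changes the sign of the differential of the cone, which is why both terms on the
right of `hb` are negative. -/
theorem coneLiftX_comm (f : P ⟶ Q) (a : L ⟶ P) (b : Cochain L Q (-1))
    (hb : ∀ p q r (hp : p + -1 = q) (hr : r + -1 = p),
      L.d p r ≫ b.v r p hr = -(a.f p ≫ f.f p) - b.v p q hp ≫ Q.d q p)
    (p q r s : ℤ) (hp : p + -1 = q) (hr : r + -1 = s) (h : p + 1 = r) :
    coneLiftX f a b p q hp ≫ (-(mappingCone f).d q s) = L.d p r ≫ coneLiftX f a b r s hr := by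
  obtain rfl : s = p := by omega
  simp only [coneLiftX, Preadditive.comp_neg, Preadditive.add_comp, Category.assoc,
    Preadditive.comp_add]
  rw [inl_v_d f s q r hp hr, inr_f_d, ← Category.assoc (L.d s r) (b.v r s hr), hb s q r hp hr,
    ← a.comm_assoc]
  simp only [Preadditive.comp_sub, Preadditive.sub_comp, Preadditive.neg_comp, Category.assoc]
  abel

/-- The map to the shifted cone whose components are a chain map `a : L → P` and a homotopy `b` from
`-(a ≫ f)` to zero. -/
def coneLift (f : P ⟶ Q) (a : L ⟶ P) (b : Cochain L Q (-1))
    (hb : ∀ p q r (hp : p + -1 = q) (hr : r + -1 = p),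
      L.d p r ≫ b.v r p hr = -(a.f p ≫ f.f p) - b.v p q hp ≫ Q.d q p) :
    L ⟶ (mappingCone f)⟦(-1 : ℤ)⟧ where
  f p := coneLiftX f a b p (p + -1) rfl
  comm' p r h := by
    have hd : ((mappingCone f)⟦(-1 : ℤ)⟧).d p r = -(mappingCone f).d (p + -1) (r + -1) := by
      simp
    exact (congrArg (fun t => coneLiftX f a b p (p + -1) rfl ≫ t) hd).trans
      (coneLiftX_comm f a b hb p _ r _ rfl rfl h)

theorem isIso_coneLiftX (f : P ⟶ Q) (a : L ⟶ P) (b : Cochain L Q (-1)) (p q : ℤ) (h : p + -1 = q)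
    (a' : P.X p ⟶ L.X p) (b' : Q.X q ⟶ L.X p) (haa : a' ≫ a.f p = 𝟙 _)
    (hbb : b' ≫ b.v p q h = 𝟙 _) (hab : a' ≫ b.v p q h = 0) (hba : b' ≫ a.f p = 0)
    (hs : a.f p ≫ a' + b.v p q h ≫ b' = 𝟙 _) : IsIso (coneLiftX f a b p q h) := by
  have h' : q + 1 = p := by omega
  -- The inverse sends the summand P^p by `a'` and the summand Q^q by `b'`.
  refine ⟨(fst f).1.v q p h' ≫ a' + (snd f).v q q (add_zero q) ≫ b', ?_, ?_⟩
  · simp [coneLiftX, hs]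
  · rw [← id_X f q p h']
    simp only [coneLiftX, Preadditive.add_comp, Preadditive.comp_add, Category.assoc,
      reassoc_of% haa, reassoc_of% hbb, reassoc_of% hab, reassoc_of% hba]
    simp

theorem coneLift_naturality {f : P ⟶ Q} {a : L ⟶ P} {b : Cochain L Q (-1)} {hb}
    {f' : P' ⟶ Q'} {a' : L' ⟶ P'} {b' : Cochain L' Q' (-1)} {hb'}
    (l : L ⟶ L') (g : P ⟶ P') (k : Q ⟶ Q') (w : f ≫ k = g ≫ f')
    (ha : l ≫ a' = a ≫ g)
    (hbk : ∀ p q (h : p + -1 = q), l.f p ≫ b'.v p q h = b.v p q h ≫ k.f q) :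
    l ≫ coneLift f' a' b' hb' =
      coneLift f a b hb ≫ (mappingCone.map f f' g k w)⟦(-1 : ℤ)⟧' := by
  ext p
  have h1 := congrArg (fun t => t.f p) ha
  simp only [HomologicalComplex.comp_f] at h1
  change l.f p ≫ coneLiftX f' a' b' p (p + -1) rfl =
    coneLiftX f a b p (p + -1) rfl ≫ (mappingCone.map f f' g k w).f (p + -1)
  simp only [coneLiftX, Preadditive.comp_add, Preadditive.add_comp, Category.assoc,
    reassoc_of% h1]
  rw [← Category.assoc (l.f p) (b'.v _ _ _), hbk]
  simp [mappingCone.map]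

end ShiftedCone

/-! ### The case of complexes extended by zero -/

section Extend

open CochainComplex CochainComplex.HomComplex CochainComplex.mappingCone ComplexShape

variable {C : Type*} [Category* C] [Preadditive C] [HasZeroObject C]

variable {L P Q L' P' Q' : CochainComplex C ℕ}

/-- The extension by zero of a family of morphisms of degree `-1`. -/
def extendCochain (b : ∀ n, L.X (n + 1) ⟶ Q.X n) :
    Cochain (L.extend embeddingUpNat) (Q.extend embeddingUpNat) (-1) :=
  Cochain.mk fun p q h => match p, q with
    | p, .ofNat n => (L.extendXIso embeddingUpNat (i := n + 1) (i' := p)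
        (by simp at h ⊢; omega)).hom ≫ b n ≫
          (Q.extendXIso embeddingUpNat (i := n) rfl).inv
    | _, .negSucc _ => 0

theorem extendCochain_v (b : ∀ n, L.X (n + 1) ⟶ Q.X n) (n : ℕ) (p q : ℤ) (h : p + -1 = q)
    (hp : embeddingUpNat.f (n + 1) = p) (hq : embeddingUpNat.f n = q) :
    (extendCochain b).v p q h = (L.extendXIso embeddingUpNat hp).hom ≫ b n ≫
          (Q.extendXIso embeddingUpNat hq).inv := by
  subst hq
  rfl

theorem isZero_extend_X_of_neg (L : CochainComplex C ℕ) (p : ℤ) (hp : p < 0) :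
    IsZero ((L.extend embeddingUpNat).X p) :=
  HomologicalComplex.isZero_extend_X _ _ _ fun i => by simp; omega

/-- The relation in degree 0 is stated separately because the extension of `Q` vanishes in degree
-1, so the term with the differential of `Q` is absent there. -/
theorem extendCochain_homotopy (f : P ⟶ Q) (a : L ⟶ P) (b : ∀ n, L.X (n + 1) ⟶ Q.X n)
    (hb0 : L.d 0 1 ≫ b 0 = -(a.f 0 ≫ f.f 0))
    (hb : ∀ n, L.d (n + 1) (n + 2) ≫ b (n + 1) =
      -(a.f (n + 1) ≫ f.f (n + 1)) - b n ≫ Q.d n (n + 1))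
    (p q r : ℤ) (hp : p + -1 = q) (hr : r + -1 = p) :
    (L.extend embeddingUpNat).d p r ≫ (extendCochain b).v r p hr =
      -((HomologicalComplex.extendMap a embeddingUpNat).f p ≫
        (HomologicalComplex.extendMap f embeddingUpNat).f p) -
          (extendCochain b).v p q hp ≫ (Q.extend embeddingUpNat).d q p := by
  rcases p with (_ | n) | n
  · have hr' : embeddingUpNat.f 1 = r := by simp at hr ⊢; omega
    have hq : IsZero ((Q.extend embeddingUpNat).X q) :=
      isZero_extend_X_of_neg _ _ (by simp at hp; omega)
    have h0 : embeddingUpNat.f 0 = Int.ofNat 0 := rfl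
    rw [hq.eq_of_tgt ((extendCochain b).v _ q hp) 0, zero_comp, sub_zero,
      extendCochain_v b 0 r _ hr hr' h0, HomologicalComplex.extend_d_eq _ _ h0 hr',
      HomologicalComplex.extendMap_f a _ h0, HomologicalComplex.extendMap_f f _ h0]
    simp [reassoc_of% hb0]
  · have hr' : embeddingUpNat.f (n + 2) = r := by simp at hr ⊢; omega
    have hq : embeddingUpNat.f n = q := by simp at hp ⊢; omega
    have h0 : embeddingUpNat.f (n + 1) = Int.ofNat (n + 1) := rfl
    rw [extendCochain_v b n _ q hp h0 hq,
      extendCochain_v b (n + 1) r _ hr hr' h0, HomologicalComplex.extend_d_eq _ _ h0 hr',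
      HomologicalComplex.extend_d_eq _ _ hq h0,
      HomologicalComplex.extendMap_f a _ h0, HomologicalComplex.extendMap_f f _ h0]
    simp [reassoc_of% (hb n)]
  · exact (isZero_extend_X_of_neg L _ (Int.negSucc_lt_zero n)).eq_of_src _ _

theorem extendCochain_naturality {b : ∀ n, L.X (n + 1) ⟶ Q.X n} {b' : ∀ n, L'.X (n + 1) ⟶ Q'.X n}
    (l : L ⟶ L') (k : Q ⟶ Q') (h : ∀ n, l.f (n + 1) ≫ b' n = b n ≫ k.f n) (p q : ℤ)
    (hp : p + -1 = q) :
    (HomologicalComplex.extendMap l embeddingUpNat).f p ≫ (extendCochain b').v p q hp =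
      (extendCochain b).v p q hp ≫ (HomologicalComplex.extendMap k embeddingUpNat).f q := by
  rcases q with n | n
  · have h0 : embeddingUpNat.f n = Int.ofNat n := rfl
    have hp' : embeddingUpNat.f (n + 1) = p := by simp at hp ⊢; omega
    rw [extendCochain_v b n _ _ hp hp' h0, extendCochain_v b' n _ _ hp hp' h0,
      HomologicalComplex.extendMap_f l _ hp', HomologicalComplex.extendMap_f k _ h0]
    simp [reassoc_of% (h n)]
  · exact (isZero_extend_X_of_neg Q' _ (Int.negSucc_lt_zero n)).eq_of_tgt _ _

variable [HasBinaryBiproducts C]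

/-- A chain map `a : L → P` and maps `b` of degree `-1` with `b d = -f a - d b` that are the components
of isomorphisms `L^n ≅ P^n ⊕ Q^(n-1)` form an isomorphism to the shifted cone. -/
theorem isIso_coneLift_extend (f : P ⟶ Q) (a : L ⟶ P) (b : ∀ n, L.X (n + 1) ⟶ Q.X n)
    (hb0 : L.d 0 1 ≫ b 0 = -(a.f 0 ≫ f.f 0))
    (hb : ∀ n, L.d (n + 1) (n + 2) ≫ b (n + 1) =
      -(a.f (n + 1) ≫ f.f (n + 1)) - b n ≫ Q.d n (n + 1))
    (a' : ∀ n, P.X n ⟶ L.X n) (b' : ∀ n, Q.X n ⟶ L.X (n + 1))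
    (haa : ∀ n, a' n ≫ a.f n = 𝟙 _) (hbb : ∀ n, b' n ≫ b n = 𝟙 _)
    (hab : ∀ n, a' (n + 1) ≫ b n = 0) (hba : ∀ n, b' n ≫ a.f (n + 1) = 0)
    (hs0 : a.f 0 ≫ a' 0 = 𝟙 _) (hs : ∀ n, a.f (n + 1) ≫ a' (n + 1) + b n ≫ b' n = 𝟙 _) :
    IsIso (coneLift (HomologicalComplex.extendMap f embeddingUpNat)
      (HomologicalComplex.extendMap a embeddingUpNat) (extendCochain b)
      (extendCochain_homotopy f a b hb0 hb)) := by
  have key (p q : ℤ) (hp : p + -1 = q) :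
      IsIso (coneLiftX (HomologicalComplex.extendMap f embeddingUpNat)
        (HomologicalComplex.extendMap a embeddingUpNat) (extendCochain b) p q hp) := by
    rcases p with (_ | n) | n
    · have hq : IsZero ((Q.extend embeddingUpNat).X q) :=
        isZero_extend_X_of_neg _ _ (by simp at hp; omega)
      have h0 : embeddingUpNat.f 0 = Int.ofNat 0 := rfl
      refine isIso_coneLiftX _ _ _ _ _ _ ((P.extendXIso _ h0).hom ≫ a' 0 ≫ (L.extendXIso _ h0).inv)
        0 ?_ (hq.eq_of_src _ _) (hq.eq_of_tgt _ _) zero_comp ?_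
      · rw [HomologicalComplex.extendMap_f a _ h0]
        simp [reassoc_of% (haa 0)]
      · rw [HomologicalComplex.extendMap_f a _ h0]
        simp [reassoc_of% hs0]
    · have hq : embeddingUpNat.f n = q := by simp at hp ⊢; omega
      have h0 : embeddingUpNat.f (n + 1) = Int.ofNat (n + 1) := rfl
      refine isIso_coneLiftX _ _ _ _ _ _
        ((P.extendXIso _ h0).hom ≫ a' (n + 1) ≫ (L.extendXIso _ h0).inv)
        ((Q.extendXIso _ hq).hom ≫ b' n ≫ (L.extendXIso _ h0).inv) ?_ ?_ ?_ ?_ ?_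
      · rw [HomologicalComplex.extendMap_f a _ h0]
        simp [reassoc_of% (haa (n + 1))]
      · rw [extendCochain_v b n _ q hp h0 hq]
        simp [reassoc_of% (hbb n)]
      · rw [extendCochain_v b n _ q hp h0 hq]
        simp [reassoc_of% (hab n)]
      · rw [HomologicalComplex.extendMap_f a _ h0]
        simp [reassoc_of% (hba n)]
      · rw [HomologicalComplex.extendMap_f a _ h0, extendCochain_v b n _ q hp h0 hq]
        simp only [Category.assoc, Iso.inv_hom_id_assoc, ← Preadditive.comp_add]
        rw [← Category.assoc (a.f _), ← Category.assoc (b n), ← Preadditive.add_comp, hs]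
        simp
    -- In negative degrees all three objects are zero, so zero maps serve as the inverse.
    · have hP := isZero_extend_X_of_neg P _ (Int.negSucc_lt_zero n)
      have hL := isZero_extend_X_of_neg L _ (Int.negSucc_lt_zero n)
      have hQ := isZero_extend_X_of_neg Q q (by omega)
      exact isIso_coneLiftX _ _ _ _ _ _ 0 0 (hP.eq_of_src _ _) (hQ.eq_of_src _ _)
        (hP.eq_of_src _ _) (hQ.eq_of_src _ _) (hL.eq_of_src _ _)
  have (p : ℤ) : IsIso ((coneLift (HomologicalComplex.extendMap f embeddingUpNat)
      (HomologicalComplex.extendMap a embeddingUpNat) (extendCochain b)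
      (extendCochain_homotopy f a b hb0 hb)).f p) := key p _ rfl
  exact HomologicalComplex.Hom.isIso_of_components _

end Extend

/-! ### Partial sums -/

section PartialSum

variable {M N : Type*} [AddCommGroup M] [Module K M]

variable (K M) in
/-- The sum of the entries of index at most `k`. -/
def partialSum (n k : ℕ) : (Fin (n + 1) → M) →ₗ[K] M :=
  ∑ i : Fin (n + 1), if (i : ℕ) ≤ k then LinearMap.proj i else 0

theorem partialSum_apply (n k : ℕ) (x : Fin (n + 1) → M) :
    partialSum K M n k x = ∑ i : Fin (n + 1), if (i : ℕ) ≤ k then x i else 0 := by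
  rw [partialSum, LinearMap.sum_apply]
  refine Finset.sum_congr rfl fun i _ => ?_
  split_ifs <;> rfl

theorem partialSum_zero (n : ℕ) (x : Fin (n + 1) → M) : partialSum K M n 0 x = x 0 := by
  rw [partialSum_apply, Finset.sum_eq_single 0]
  · simp
  · intro i _ hi
    exact if_neg fun h => hi (Fin.ext (Nat.le_zero.1 h))
  · exact fun h => absurd (Finset.mem_univ _) h

theorem partialSum_succ (n k : ℕ) (h : k + 1 < n + 1) (x : Fin (n + 1) → M) :
    partialSum K M n (k + 1) x = partialSum K M n k x + x ⟨k + 1, h⟩ := by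
  have : x ⟨k + 1, h⟩ = ∑ i : Fin (n + 1), if i = ⟨k + 1, h⟩ then x i else 0 := by simp
  rw [this, partialSum_apply, partialSum_apply, ← Finset.sum_add_distrib]
  refine Finset.sum_congr rfl fun i _ => ?_
  simp only [Fin.ext_iff]
  split_ifs <;> first | omega | simp

theorem partialSum_of_le (n k : ℕ) (h : n ≤ k) (x : Fin (n + 1) → M) :
    partialSum K M n k x = ∑ i, x i := by
  rw [partialSum_apply]
  exact Finset.sum_congr rfl fun i _ => if_pos (by omega)

/-- The entries are the differences of consecutive partial sums. -/
theorem eq_of_partialSum_eq (n : ℕ) (x y : Fin (n + 1) → M)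
    (h : ∀ k, partialSum K M n k x = partialSum K M n k y) : x = y := by
  funext ⟨i, hi⟩
  cases i with
  | zero => simpa [partialSum_zero] using h 0
  | succ k =>
    have := h (k + 1)
    rw [partialSum_succ n k hi, partialSum_succ n k hi, h k] at this
    exact add_left_cancel this

theorem exists_partialSum_eq (n : ℕ) (g : ℕ → M) :
    ∃ x : Fin (n + 1) → M, ∀ k ≤ n, partialSum K M n k x = g k := by
  -- Consecutive differences of `g`. The index 0 is set apart because the truncated `0 - 1` would
  -- subtract `g 0` from itself.
  refine ⟨fun i => g i - if (i : ℕ) = 0 then 0 else g (i - 1), fun k => ?_⟩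
  induction k with
  | zero => simp [partialSum_zero]
  | succ k ih =>
    intro hk
    rw [partialSum_succ n k (by omega), ih (by omega)]
    simp

theorem partialSum_sum_single (n m k : ℕ) (θ : Fin (n + 1) → Fin (m + 1)) (x : Fin (n + 1) → M) :
    partialSum K M m k (∑ i, Pi.single (θ i) (x i)) =
      ∑ i, if (θ i : ℕ) ≤ k then x i else 0 := by
  rw [map_sum]
  refine Finset.sum_congr rfl fun i _ => ?_
  rw [partialSum_apply, Finset.sum_eq_single (θ i)]
  · simp
  · intro j _ hj
    simp [hj]
  · simp

end PartialSum

/-! ### The coordinates of the relation module of a power of a presentation -/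

section Coordinates

open Simplicial

variable {A A' : ModuleCat.{v} K}

/-- The entry of index `n` of the extended sequence is the image under `φ` of the last coordinate,
and `φ` is injective. Identities in F^n ⊕ R can therefore be checked on sequences in F, without
treating the R-coordinate separately. -/
theorem dsum_mixed_ext {A B : ModuleCat.{v} K} {φ : B ⟶ A} (hφ : Function.Injective φ.hom) {n : ℕ}
    {x y : dsum (mixed A B n)} (h : ∀ k ≤ n, extSeq φ n x k = extSeq φ n y k) : x = y := by
  funext o
  cases o with
  | none => exact hφ (by simpa [extSeq] using h n le_rfl)
  | some k => simpa [extSeq] using h k k.2.le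

theorem Pres.φ_injective (p : Pres A) : Function.Injective p.φ.hom := Subtype.val_injective

theorem Pres.mem_ker_pow_iff (p : Pres A) (n : ℕ) (x : Fin (n + 1) → p.F) :
    x ∈ LinearMap.ker (p.pow n).π.hom ↔ ∑ i, x i ∈ LinearMap.ker p.π.hom := by
  change (p.pow n).π.hom x = 0 ↔ p.π.hom (∑ i, x i) = 0
  rw [map_sum]
  exact Eq.congr_left (p.pow_π_apply n x)

/-- The tuple of elements of `F` underlying a relation for `p ⊔ ... ⊔ p`. -/
def Pres.powVal (p : Pres A) (n : ℕ) : (p.pow n).R →ₗ[K] (Fin (n + 1) → p.F) :=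
  (LinearMap.ker (p.pow n).π.hom).subtype

theorem Pres.sum_powVal_mem (p : Pres A) (n : ℕ) (x : (p.pow n).R) :
    partialSum K p.F n n (p.powVal n x) ∈ LinearMap.ker p.π.hom := by
  rw [partialSum_of_le n n le_rfl]
  exact (p.mem_ker_pow_iff n _).1 x.2

/-- The map `Ker(p ⊔ ... ⊔ p) → F^n ⊕ R` given by the partial sums
`(a_0, ..., a_n) ↦ (a_0, a_0 + a_1, ..., a_0 + ... + a_n)`. -/
def Pres.relCoord (p : Pres A) (n : ℕ) : (p.pow n).R ⟶ dsum (mixed p.F p.R n) :=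
  ModuleCat.ofHom (LinearMap.pi fun o =>
    match o with
    | none => (partialSum K p.F n n ∘ₗ p.powVal n).codRestrict _ (p.sum_powVal_mem n)
    | some k => partialSum K p.F n k ∘ₗ p.powVal n)

theorem Pres.extSeq_relCoord (p : Pres A) (n : ℕ) (x : (p.pow n).R) (k : ℕ) :
    extSeq p.φ n ((p.relCoord n).hom x) k = partialSum K p.F n k (p.powVal n x) := by
  unfold extSeq
  split_ifs with h
  · rfl
  · rw [partialSum_of_le n k (by omega), ← partialSum_of_le (K := K) n n le_rfl]
    rfl

theorem Pres.relCoord_bijective (p : Pres A) (n : ℕ) :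
    Function.Bijective (p.relCoord n).hom := by
  constructor
  · intro x y h
    refine Subtype.ext (eq_of_partialSum_eq (K := K) n (p.powVal n x) (p.powVal n y) fun k => ?_)
    rw [← p.extSeq_relCoord, ← p.extSeq_relCoord, h]
  · intro c
    -- A tuple with the prescribed partial sums. Its total is the entry of index `n`, which comes
    -- from R, so the tuple is a relation.
    obtain ⟨x, hx⟩ := exists_partialSum_eq (K := K) n (extSeq p.φ n c)
    have hx' : x ∈ LinearMap.ker (p.pow n).π.hom := by
      rw [p.mem_ker_pow_iff, ← partialSum_of_le (K := K) n n le_rfl, hx n le_rfl, extSeq,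
        dif_neg (lt_irrefl n)]
      exact (c none).2
    refine ⟨⟨x, hx'⟩, dsum_mixed_ext p.φ_injective fun k hk => ?_⟩
    rw [p.extSeq_relCoord]
    exact hx k hk

/-- The isomorphism `Ker(p ⊔ ... ⊔ p) ≅ F^n ⊕ R` given by the partial sums. -/
def Pres.relIso (p : Pres A) (n : ℕ) : (p.pow n).R ≅ dsum (mixed p.F p.R n) :=
  (LinearEquiv.ofBijective (p.relCoord n).hom (p.relCoord_bijective n)).toModuleIso

theorem Pres.relIso_hom (p : Pres A) (n : ℕ) : (p.relIso n).hom = p.relCoord n := rfl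

/-- The cosimplicial module of the relation modules of the powers of `p`. -/
abbrev Pres.relCosimplicial (p : Pres A) : CosimplicialObject (ModuleCat.{v} K) :=
  ((CosimplicialObject.whiskering _ _).obj (relationFunctor A)).obj
    (copowers p p.powCofan p.powIsColimit)

theorem Pres.powVal_relCosimplicial_map (p : Pres A) {n m : ℕ} (θ : ⦋n⦌ ⟶ ⦋m⦌)
    (x : (p.pow n).R) :
    p.powVal m ((p.relCosimplicial.map θ).hom x) =
      ∑ i : Fin (n + 1), (Pi.single (θ.toOrderHom i) (p.powVal n x i) : Fin (m + 1) → p.F) :=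
  Pres.powDesc_apply n (fun i => p.powι m (θ.toOrderHom i)) (p.powVal n x)

/-- The entry at position `i` moves to position `θ i`, so it counts in the `k`-th partial sum
exactly when `θ i ≤ k`. -/
theorem Pres.extSeq_relCosimplicial_map (p : Pres A) {n m : ℕ} (θ : ⦋n⦌ ⟶ ⦋m⦌)
    (x : (p.pow n).R) (k : ℕ) :
    extSeq p.φ m ((p.relCoord m).hom ((p.relCosimplicial.map θ).hom x)) k =
      ∑ i : Fin (n + 1), if (θ.toOrderHom i : ℕ) ≤ k then p.powVal n x i else 0 := by
  refine (p.extSeq_relCoord m ((p.relCosimplicial.map θ).hom x) k).trans ?_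
  rw [powVal_relCosimplicial_map, partialSum_sum_single]

/-- The hypothesis says that the preimage of {0, ..., k} under `θ` is the initial segment ending at
`l`. All cofaces except the zeroth, and all codegeneracies, are computed from this criterion. -/
theorem Pres.extSeq_map_eq (p : Pres A) {n m : ℕ} (θ : ⦋n⦌ ⟶ ⦋m⦌) (x : (p.pow n).R) (k l : ℕ)
    (h : ∀ i : Fin (n + 1), (θ.toOrderHom i : ℕ) ≤ k ↔ (i : ℕ) ≤ l) :
    extSeq p.φ m ((p.relCoord m).hom ((p.relCosimplicial.map θ).hom x)) k =
      extSeq p.φ n ((p.relCoord n).hom x) l := by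
  refine (p.extSeq_relCosimplicial_map θ x k).trans ?_
  rw [extSeq_relCoord, partialSum_apply]
  exact Finset.sum_congr rfl fun i _ => if_congr (h i) rfl rfl

theorem Pres.δ_succ_relCoord (p : Pres A) (n : ℕ) (i : Fin (n + 1)) :
    p.relCosimplicial.δ i.succ ≫ p.relCoord (n + 1) = p.relCoord n ≫ diag p.φ n i := by
  apply ModuleCat.hom_ext
  apply LinearMap.ext
  intro (x : (p.pow n).R)
  refine dsum_mixed_ext p.φ_injective fun k hk => ?_
  refine (p.extSeq_map_eq (SimplexCategory.δ i.succ) x k (if k ≤ i then k else k - 1) ?_).trans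
    (extSeq_diag p.φ n i ((p.relCoord n).hom x) k).symm
  intro l
  change (i.succ.succAbove l : ℕ) ≤ k ↔ _
  simp only [Fin.succAbove, Fin.lt_def, Fin.val_castSucc, Fin.val_succ]
  split_ifs <;> simp only [Fin.val_castSucc, Fin.val_succ] <;> omega

/-- The zeroth coface omits the value 0, so the sum of the entries up to position 0 is empty. -/
theorem Pres.extSeq_δ_zero (p : Pres A) (n : ℕ) (x : (p.pow n).R) :
    extSeq p.φ (n + 1) ((p.relCoord (n + 1)).hom ((p.relCosimplicial.δ (n := n) 0).hom x)) 0 = 0 := by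
  refine (p.extSeq_relCosimplicial_map (SimplexCategory.δ 0) x 0).trans
    (Finset.sum_eq_zero fun i _ => if_neg ?_)
  change ¬ ((Fin.succAbove 0 i : ℕ) ≤ 0)
  simp

theorem Pres.extSeq_σ (p : Pres A) (n : ℕ) (i : Fin (n + 1)) (x : (p.pow (n + 1)).R) (k : ℕ) :
    extSeq p.φ n ((p.relCoord n).hom ((p.relCosimplicial.σ i).hom x)) k =
      extSeq p.φ (n + 1) ((p.relCoord (n + 1)).hom x) (if k < i then k else k + 1) := by
  refine p.extSeq_map_eq (SimplexCategory.σ i) x k _ fun l => ?_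
  change (i.predAbove l : ℕ) ≤ k ↔ _
  simp only [Fin.predAbove, Fin.lt_def, Fin.val_castSucc]
  split_ifs <;> simp <;> omega

/-- Together with `Pres.coord_eq_of_σ_eq`: in partial-sum coordinates, `σ i` and the projection
forgetting the `i`-th copy of F have the same fibres. -/
theorem Pres.σ_eq_of_coord_eq (p : Pres A) (n : ℕ) (i : Fin (n + 1)) (x y : (p.pow (n + 1)).R)
    (h : ∀ o, o ≠ some i → (p.relCoord (n + 1)).hom x o = (p.relCoord (n + 1)).hom y o) :
    (p.relCosimplicial.σ i).hom x = (p.relCosimplicial.σ i).hom y := by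
  refine (p.relCoord_bijective n).1 (dsum_mixed_ext p.φ_injective fun k hk => ?_)
  refine (p.extSeq_σ n i x k).trans (Eq.trans ?_ (p.extSeq_σ n i y k).symm)
  have hki : (if k < i then k else k + 1) ≠ i := by split_ifs <;> omega
  generalize (if k < i then k else k + 1) = l at hki
  unfold extSeq
  split_ifs
  · exact h _ (by simpa [Fin.ext_iff] using hki)
  · exact congrArg p.φ.hom (h none (by simp))

theorem Pres.coord_eq_of_σ_eq (p : Pres A) (n : ℕ) (i : Fin (n + 1)) (x y : (p.pow (n + 1)).R)
    (h : (p.relCosimplicial.σ i).hom x = (p.relCosimplicial.σ i).hom y) (o) (ho : o ≠ some i) :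
    (p.relCoord (n + 1)).hom x o = (p.relCoord (n + 1)).hom y o := by
  have key (k : ℕ) : extSeq p.φ (n + 1) ((p.relCoord (n + 1)).hom x) (if k < i then k else k + 1) =
      extSeq p.φ (n + 1) ((p.relCoord (n + 1)).hom y) (if k < i then k else k + 1) :=
    (p.extSeq_σ n i x k).symm.trans ((congrArg
      (fun z => extSeq p.φ n ((p.relCoord n).hom z) k) h).trans (p.extSeq_σ n i y k))
  cases o with
  | none =>
    -- Since `i ≤ n`, the entry `n` after the codegeneracy is the entry `n + 1` before it, the one
    -- that comes from R.
    have := key n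
    rw [if_neg (by omega)] at this
    exact p.φ_injective (by simpa [extSeq] using this)
  | some l =>
    have hl : (l : ℕ) ≠ i := fun e => ho (by rw [Fin.ext e])
    -- The position to which `l ≠ i` moves once `i` has been removed.
    have := key (if (l : ℕ) < i then l else l - 1)
    have e : (if (if (l : ℕ) < i then (l : ℕ) else l - 1) < i then
        (if (l : ℕ) < i then (l : ℕ) else l - 1) else
        (if (l : ℕ) < i then (l : ℕ) else l - 1) + 1) = l := by
      split_ifs <;> omega
    rw [e] at this
    simpa only [extSeq, dif_pos l.2] using this

theorem Square.pow_rel_relCoord {p : Pres A} {p' : Pres A'} (s : Square p p') (n : ℕ) :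
    (s.pow n).rel ≫ p'.relCoord n = p.relCoord n ≫ dsumMap (mixedMap s.rel s.top n) := by
  apply ModuleCat.hom_ext
  apply LinearMap.ext
  intro (x : (p.pow n).R)
  refine dsum_mixed_ext p'.φ_injective fun k hk => ?_
  refine Eq.trans ?_ (extSeq_map s.rel s.top s.φ_top n ((p.relCoord n).hom x) k).symm
  refine (p'.extSeq_relCoord n ((s.pow n).rel.hom x) k).trans ?_
  rw [p.extSeq_relCoord, partialSum_apply, partialSum_apply, map_sum]
  refine Finset.sum_congr rfl fun i _ => ?_
  rw [apply_ite s.top.hom, map_zero]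
  rfl

end Coordinates

/-! ### Vanishing criteria -/

section Vanishing

variable (Φ : ModuleCat.{v} K ⥤ ModuleCat.{v} K)

theorem map_map_apply {M N P : ModuleCat.{v} K} (f : M ⟶ N) (g : N ⟶ P) (x : Φ.obj M) :
    (Φ.map g).hom ((Φ.map f).hom x) = (Φ.map (f ≫ g)).hom x := by
  rw [Functor.map_comp]
  rfl

theorem map_eq_zero_of_factor {M N N' : ModuleCat.{v} K} {f : M ⟶ N} {g : M ⟶ N'} (t : N ⟶ N')
    (h : f ≫ t = g) {x : Φ.obj M} (hx : (Φ.map f).hom x = 0) : (Φ.map g).hom x = 0 := by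
  rw [← h, ← map_map_apply, hx, map_zero]

/-- A map with zero `j`-th coordinate factors through the embedding `em A j`, whose image is killed
by the projection to the cross effect. -/
theorem crossProj_map_eq_zero {ι : Type} [Fintype ι] [DecidableEq ι] {M : ModuleCat.{v} K}
    {A : ι → ModuleCat.{v} K} (g : M ⟶ dsum A) (j : ι) (h : ∀ x, g.hom x j = 0) (x : Φ.obj M) :
    crossProj Φ A ((Φ.map g).hom x) = 0 := by
  have hg : g = (g ≫ pr A j) ≫ em A j := by
    rw [Category.assoc, pr_em]
    refine hom_dsum_ext fun y i => ?_
    rw [ModuleCat.hom_comp, LinearMap.comp_apply, coordProj_apply]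
    by_cases hi : i = j
    · subst hi
      simp [h]
    · simp [hi]
  rw [hg, ← map_map_apply, crossProj_map_em]

/-- A map `g` that depends only on the coordinates different from `j` kills, after applying `Φ`,
everything that is killed by forgetting the `j`-th coordinate. -/
theorem map_eq_zero_of_map_pr_eq_zero {ι : Type} [Fintype ι] [DecidableEq ι]
    {A : ι → ModuleCat.{v} K} {N : ModuleCat.{v} K} (g : dsum A ⟶ N) (j : ι)
    (h : ∀ x y : dsum A, (∀ i, i ≠ j → x i = y i) → g.hom x = g.hom y) {z : Φ.obj (dsum A)}
    (hz : (Φ.map (pr A j)).hom z = 0) : (Φ.map g).hom z = 0 := by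
  refine map_eq_zero_of_factor Φ (em A j ≫ g) ?_ hz
  rw [← Category.assoc, pr_em]
  apply ModuleCat.hom_ext
  apply LinearMap.ext
  intro x
  refine h _ _ fun i hi => ?_
  exact (coordProj_apply _ _ _ _).trans (if_pos (by simpa using hi))

end Vanishing

/-! ### Discarding the last summand -/

section DropLast

variable {A B A' B' : ModuleCat.{v} K}

variable (A B) in
/-- The projection `A^(m+1) ⊕ B → A^(m+1) = A^m ⊕ A`. -/
def dropLast (m : ℕ) : dsum (mixed A B (m + 1)) ⟶ dsum (mixed A A m) :=
  ModuleCat.ofHom (LinearMap.pi fun o =>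
    match o with
    | none => LinearMap.proj (φ := fun o => mixed A B (m + 1) o) (some (Fin.last m))
    | some k => LinearMap.proj (φ := fun o => mixed A B (m + 1) o) (some k.castSucc))

variable (A B) in
/-- The embedding `A^m ⊕ A = A^(m+1) → A^(m+1) ⊕ B`. -/
def addLast (m : ℕ) : dsum (mixed A A m) ⟶ dsum (mixed A B (m + 1)) :=
  ModuleCat.ofHom (LinearMap.pi fun o =>
    match o with
    | none => 0
    | some k => if h : (k : ℕ) < m then
        LinearMap.proj (φ := fun o => mixed A A m o) (some ⟨k, h⟩)
      else LinearMap.proj (φ := fun o => mixed A A m o) none)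

theorem addLast_some (m : ℕ) (x : dsum (mixed A A m)) (k : Fin (m + 1)) :
    (addLast A B m).hom x (some k) = extSeq (𝟙 A) m x k := by
  change (if h : (k : ℕ) < m then
        LinearMap.proj (φ := fun o => mixed A A m o) (some ⟨k, h⟩)
      else LinearMap.proj (φ := fun o => mixed A A m o) none : dsum (mixed A A m) →ₗ[K] A) x = _
  unfold extSeq
  split_ifs <;> rfl

theorem extSeq_dropLast (m : ℕ) (x : dsum (mixed A B (m + 1))) (k : Fin (m + 1)) :
    extSeq (𝟙 A) m ((dropLast A B m).hom x) k = x (some k) := by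
  unfold extSeq
  split_ifs with h
  · rfl
  · obtain rfl : k = Fin.last m := Fin.ext (by simp; omega)
    rfl

theorem extSeq_dropLast_of_lt (φ : B ⟶ A) (m : ℕ) (x : dsum (mixed A B (m + 1))) (k : ℕ)
    (hk : k < m + 1) :
    extSeq (𝟙 A) m ((dropLast A B m).hom x) k = extSeq φ (m + 1) x k := by
  refine (extSeq_dropLast m x ⟨k, hk⟩).trans ?_
  rw [extSeq, dif_pos hk]

theorem addLast_dropLast (m : ℕ) : addLast A B m ≫ dropLast A B m = 𝟙 _ := by
  refine hom_dsum_ext fun x o => ?_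
  cases o with
  | none =>
    refine (addLast_some m x (Fin.last m)).trans ?_
    simp [extSeq]
  | some k =>
    refine (addLast_some m x k.castSucc).trans ?_
    simp [extSeq]

theorem dropLast_addLast_none (m : ℕ) (x : dsum (mixed A B (m + 1))) :
    (dropLast A B m ≫ addLast A B m).hom x none = 0 := rfl

theorem dropLast_addLast_some (m : ℕ) (x : dsum (mixed A B (m + 1))) (k : Fin (m + 1)) :
    (dropLast A B m ≫ addLast A B m).hom x (some k) = x (some k) :=
  (addLast_some m ((dropLast A B m).hom x) k).trans (extSeq_dropLast m x k)

/-- For `i = m` the left side repeats the last copy of `A`; when that copy is regarded as the final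
summand, this is the last map Δ^m of the identity of `A`. -/
theorem diag_castSucc_dropLast (φ : B ⟶ A) (m : ℕ) (i : Fin (m + 1)) :
    diag φ (m + 1) i.castSucc ≫ dropLast A B (m + 1) = dropLast A B m ≫ diag (𝟙 A) m i := by
  refine hom_dsum_ext fun x o => ?_
  cases o with
  | none =>
    refine (diag_some φ (m + 1) i.castSucc (Fin.last (m + 1)) x).trans ?_
    have : ¬ (m + 1 ≤ (i : ℕ)) := by omega
    simp only [Fin.val_last, Fin.val_castSucc, if_neg this]
    simp only [Nat.add_sub_cancel, extSeq, dif_pos (Nat.lt_succ_self m)]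
    rfl
  | some k =>
    refine (diag_some φ (m + 1) i.castSucc k.castSucc x).trans (Eq.trans ?_
      (diag_some (𝟙 A) m i k ((dropLast A B m).hom x)).symm)
    refine (extSeq_dropLast_of_lt φ m x _ ?_).symm
    have := k.2
    simp only [Fin.val_castSucc]
    split_ifs <;> omega

/-- Δ^n appends φ(b) and b, and forgetting b leaves φ(b) in the final place. This coface is the
source of the map C_Φ(1_F, φ_p) in the cone. -/
theorem diag_last_dropLast (φ : B ⟶ A) (n : ℕ) :
    diag φ n (Fin.last n) ≫ dropLast A B n = dsumMap (mixedMap φ (𝟙 A) n) := by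
  refine hom_dsum_ext fun x o => ?_
  cases o with
  | none =>
    refine (diag_some φ n (Fin.last n) (Fin.last n) x).trans ?_
    simp [extSeq]
    rfl
  | some k =>
    refine (diag_some φ n (Fin.last n) k.castSucc x).trans ?_
    refine (congrArg (extSeq φ n x) (if_pos k.2.le)).trans ?_
    exact dif_pos k.2

theorem dropLast_natural (α : B ⟶ B') (β : A ⟶ A') (m : ℕ) :
    dsumMap (mixedMap α β (m + 1)) ≫ dropLast A' B' m =
      dropLast A B m ≫ dsumMap (mixedMap β β m) := by
  refine hom_dsum_ext fun x o => ?_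
  cases o <;> rfl

end DropLast

/-! ### The components of the isomorphism -/

section Components

open Simplicial

variable {A A' : ModuleCat.{v} K} (Φ : ModuleCat.{v} K ⥤ ModuleCat.{v} K) (p : Pres A)

/-- The cosimplicial module `Φ(R_A(p^•))`. -/
abbrev Pres.mapCosimplicial : CosimplicialObject (ModuleCat.{v} K) :=
  ((CosimplicialObject.whiskering _ _).obj (relationFunctor A ⋙ Φ)).obj
    (copowers p p.powCofan p.powIsColimit)

/-- The map `N^n ⊆ Φ(Ker(p ⊔ ... ⊔ p)) → Φ(F^n ⊕ R)` given by the partial sums. -/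
def normalizedCoord (n : ℕ) :
    normalizedSubmodule (p.mapCosimplicial Φ) n →ₗ[K] Φ.obj (dsum (mixed p.F p.R n)) :=
  (Φ.map (p.relCoord n)).hom ∘ₗ (normalizedSubmodule (p.mapCosimplicial Φ) n).subtype

theorem normalizedCoord_injective (n : ℕ) : Function.Injective (normalizedCoord Φ p n) := by
  intro x y h
  refine Subtype.ext ?_
  exact (Φ.mapIso (p.relIso n)).toLinearEquiv.injective h

/-- A codegeneracy and the corresponding coordinate projection are both split epimorphisms and have
the same fibres. Each thus factors through the other, and `Φ` preserves the factorizations, so their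
images under `Φ` have the same kernel. -/
theorem mem_normalizedSubmodule_iff (n : ℕ) (x : Φ.obj (p.pow n).R) :
    x ∈ normalizedSubmodule (p.mapCosimplicial Φ) n ↔
      ∀ i : Fin n, (Φ.map (pr (mixed p.F p.R n) (some i))).hom
        ((Φ.map (p.relCoord n)).hom x) = 0 := by
  cases n with
  | zero => exact ⟨fun _ i => i.elim0, fun _ => trivial⟩
  | succ n =>
    refine (Submodule.mem_iInf (p := fun i : Fin (n + 1) =>
      LinearMap.ker ((p.mapCosimplicial Φ).σ i).hom) (x := x)).trans (forall_congr' fun i => ?_)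
    change (Φ.map (p.relCosimplicial.σ i)).hom x = 0 ↔ _
    rw [map_map_apply]
    constructor
    · intro h
      refine map_eq_zero_of_factor Φ
        -- The coface is a section of the codegeneracy: applying `σ` and then `δ` changes only the
        -- `i`-th coordinate, which the projection forgets.
        (p.relCosimplicial.δ i.castSucc ≫ p.relCoord (n + 1) ≫ pr _ (some i)) ?_ h
      refine hom_dsum_ext fun y o => ?_
      refine p.coord_eq_of_σ_eq n i
        ((p.relCosimplicial.δ i.castSucc).hom ((p.relCosimplicial.σ i).hom y)) y ?_ o.1 o.2
      exact congrArg (fun f => f.hom ((p.relCosimplicial.σ i).hom y))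
        (p.relCosimplicial.δ_comp_σ_self (i := i))
    · intro h
      refine map_eq_zero_of_factor Φ
        (em _ (some i) ≫ (p.relIso (n + 1)).inv ≫ p.relCosimplicial.σ i) ?_ h
      apply ModuleCat.hom_ext
      apply LinearMap.ext
      intro (y : (p.pow (n + 1)).R)
      refine p.σ_eq_of_coord_eq n i ((p.relIso (n + 1)).inv.hom
        ((pr _ (some i) ≫ em _ (some i)).hom ((p.relCoord (n + 1)).hom y))) y fun o ho => ?_
      refine (congrFun (congrArg (fun f => f.hom
        ((pr _ (some i) ≫ em _ (some i)).hom ((p.relCoord (n + 1)).hom y)))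
        (p.relIso (n + 1)).inv_hom_id) o).trans ?_
      rw [pr_em]
      exact (coordProj_apply _ _ _ _).trans (if_pos (by simpa using ho))

theorem pr_some_normalizedCoord (n : ℕ) (x : normalizedSubmodule (p.mapCosimplicial Φ) n)
    (i : Fin n) : (Φ.map (pr (mixed p.F p.R n) (some i))).hom (normalizedCoord Φ p n x) = 0 :=
  (mem_normalizedSubmodule_iff Φ p n x.1).1 x.2 i

/-- The element of `N^n` with given coordinates. -/
def ofNormalizedCoord {n : ℕ} {M : Type v} [AddCommGroup M] [Module K M]
    (f : M →ₗ[K] Φ.obj (dsum (mixed p.F p.R n)))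
    (hf : ∀ x (i : Fin n), (Φ.map (pr (mixed p.F p.R n) (some i))).hom (f x) = 0) :
    M →ₗ[K] normalizedSubmodule (p.mapCosimplicial Φ) n :=
  ((Φ.map (p.relIso n).inv).hom ∘ₗ f).codRestrict _ fun x => by
    refine (mem_normalizedSubmodule_iff Φ p n _).2 fun i => ?_
    rw [LinearMap.comp_apply, ← p.relIso_hom, map_map_apply Φ (p.relIso n).inv,
      Iso.inv_hom_id, Φ.map_id]
    exact hf x i

theorem normalizedCoord_ofNormalizedCoord {n : ℕ} {M : Type v} [AddCommGroup M] [Module K M]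
    (f : M →ₗ[K] Φ.obj (dsum (mixed p.F p.R n)))
    (hf : ∀ x (i : Fin n), (Φ.map (pr (mixed p.F p.R n) (some i))).hom (f x) = 0) (x : M) :
    normalizedCoord Φ p n (ofNormalizedCoord Φ p f hf x) = f x := by
  change (Φ.map (p.relIso n).hom).hom ((Φ.map (p.relIso n).inv).hom (f x)) = f x
  rw [map_map_apply, Iso.inv_hom_id, Φ.map_id]
  rfl

/-- The coordinates of the differential, projected to a cross effect. -/
theorem crossProj_altCoface {ι : Type} [Fintype ι] [DecidableEq ι] {B : ι → ModuleCat.{v} K}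
    (n : ℕ) (g : dsum (mixed p.F p.R (n + 1)) ⟶ dsum B)
    (hg : ∃ k, ∀ y, extSeq p.φ (n + 1) y 0 = 0 → g.hom y k = 0) (x : Φ.obj (p.pow n).R) :
    crossProj Φ B ((Φ.map g).hom ((Φ.map (p.relCoord (n + 1))).hom
        ((altCoface (p.mapCosimplicial Φ) n).hom x))) =
      -∑ i : Fin (n + 1), (-1 : ℤ) ^ (i : ℕ) •
        crossProj Φ B ((Φ.map (diag p.φ n i ≫ g)).hom ((Φ.map (p.relCoord n)).hom x)) := by
  obtain ⟨k, hk⟩ := hg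
  have hx := altCoface_apply (p.mapCosimplicial Φ) n x
  rw [Fin.sum_univ_succ] at hx
  let T : (p.mapCosimplicial Φ).obj ⦋n + 1⦌ →ₗ[K] crossEffect Φ B :=
    crossProj Φ B ∘ₗ (Φ.map g).hom ∘ₗ (Φ.map (p.relCoord (n + 1))).hom
  have hT (d : (p.pow n).R ⟶ (p.pow (n + 1)).R) :
      T ((Φ.map d).hom x) = crossProj Φ B ((Φ.map ((d ≫ p.relCoord (n + 1)) ≫ g)).hom x) := by
    rw [← map_map_apply, ← map_map_apply]
    rfl
  -- The zeroth coface has first entry 0, so by the assumption on `g` the composite has a zero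
  -- coordinate and dies in the cross effect.
  have h0 : T (((p.mapCosimplicial Φ).δ 0).hom x) = 0 :=
    (hT (p.relCosimplicial.δ 0)).trans (crossProj_map_eq_zero Φ _ k
      (fun (y : (p.pow n).R) => hk _ (p.extSeq_δ_zero n y)) x)
  have hi (i : Fin (n + 1)) : T (((p.mapCosimplicial Φ).δ i.succ).hom x) =
      crossProj Φ B ((Φ.map (diag p.φ n i ≫ g)).hom ((Φ.map (p.relCoord n)).hom x)) := by
    refine (hT (p.relCosimplicial.δ i.succ)).trans ?_
    rw [map_map_apply, ← Category.assoc]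
    exact congrArg (fun f => crossProj Φ B ((Φ.map (f ≫ g)).hom x)) (p.δ_succ_relCoord n i)
  refine (congrArg T hx).trans ?_
  rw [map_add, map_sum, map_zsmul, h0, smul_zero, zero_add, ← Finset.sum_neg_distrib]
  refine Finset.sum_congr rfl fun i _ => ?_
  -- The coface of index `i + 1` corresponds to Δ^i; this shift produces the global minus sign.
  rw [map_zsmul, hi, Fin.val_succ, pow_succ, mul_neg_one, neg_smul]

/-- The component `N^n → Φ(F|...|F|R)`. -/
def toCrossRel (n : ℕ) :
    normalizedSubmodule (p.mapCosimplicial Φ) n →ₗ[K] crossEffect Φ (mixed p.F p.R n) :=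
  crossProj Φ _ ∘ₗ normalizedCoord Φ p n

/-- The component `N^(n+1) → Φ(F|...|F|F)`. -/
def toCrossFree (n : ℕ) :
    normalizedSubmodule (p.mapCosimplicial Φ) (n + 1) →ₗ[K] crossEffect Φ (mixed p.F p.F n) :=
  crossProj Φ _ ∘ₗ (Φ.map (dropLast p.F p.R n)).hom ∘ₗ normalizedCoord Φ p (n + 1)

theorem toCrossRel_normalizedD (n : ℕ) (x : normalizedSubmodule (p.mapCosimplicial Φ) n) :
    toCrossRel Φ p (n + 1) ((normalizedD (p.mapCosimplicial Φ) n).hom x) =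
      -(crossD Φ p.φ n).hom (toCrossRel Φ p n x) := by
  have h := crossProj_altCoface Φ p n (𝟙 _) ⟨some 0, fun y hy => by
    rwa [extSeq, dif_pos n.succ_pos] at hy⟩ x.1
  simp only [Category.comp_id, Φ.map_id] at h
  refine h.trans ?_
  rw [crossD_apply]
  refine congrArg _ (Finset.sum_congr rfl fun i _ => ?_)
  -- Every coordinate of the source reappears in Δ^i, so projecting to the cross effect beforehand
  -- changes nothing.
  exact congrArg _ (crossProj_map_crossProj Φ _ (diag_controls p.φ n i) _).symm

theorem crossProj_diag_last (n : ℕ) (z : Φ.obj (dsum (mixed p.F p.R n))) :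
    crossProj Φ _ ((Φ.map (diag p.φ n (Fin.last n) ≫ dropLast p.F p.R n)).hom z) =
      crossEffectMap (𝟙 Φ) (mixedMap p.φ (𝟙 p.F) n) (crossProj Φ _ z) := by
  rw [diag_last_dropLast, ← crossProj_natural]
  simp

theorem toCrossFree_normalizedD_zero (x : normalizedSubmodule (p.mapCosimplicial Φ) 0) :
    toCrossFree Φ p 0 ((normalizedD (p.mapCosimplicial Φ) 0).hom x) =
      -crossEffectMap (𝟙 Φ) (mixedMap p.φ (𝟙 p.F) 0) (toCrossRel Φ p 0 x) := by
  -- The target here is F^0 ⊕ F, so the only coordinate, and hence the one killed by the zeroth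
  -- coface, is `none`.
  have h := crossProj_altCoface Φ p 0 (dropLast p.F p.R 0) ⟨none, fun y hy => by
    rwa [extSeq, dif_pos (Nat.zero_lt_one)] at hy⟩ x.1
  refine h.trans (congrArg _ ?_)
  refine (Fin.sum_univ_one _).trans ?_
  refine (one_smul ℤ _).trans ?_
  exact crossProj_diag_last Φ p 0 _

theorem toCrossFree_normalizedD_succ (n : ℕ)
    (x : normalizedSubmodule (p.mapCosimplicial Φ) (n + 1)) :
    toCrossFree Φ p (n + 1) ((normalizedD (p.mapCosimplicial Φ) (n + 1)).hom x) =
      -((-1 : ℤ) ^ (n + 1) • crossEffectMap (𝟙 Φ) (mixedMap p.φ (𝟙 p.F) (n + 1))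
        (toCrossRel Φ p (n + 1) x)) - (crossD Φ (𝟙 p.F) n).hom (toCrossFree Φ p n x) := by
  have h := crossProj_altCoface Φ p (n + 1) (dropLast p.F p.R (n + 1)) ⟨some 0, fun y hy => by
    rwa [extSeq, dif_pos (Nat.succ_pos _)] at hy⟩ x.1
  refine h.trans ?_
  -- The last coface gives the map to C_Φ(F); the others give the differential of C_Φ(F).
  rw [Fin.sum_univ_castSucc, neg_add_rev, ← sub_eq_add_neg, crossD_apply]
  refine congrArg₂ (· - ·) (congrArg _ ?_) (Finset.sum_congr rfl fun i _ => ?_)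
  · exact congrArg _ (crossProj_diag_last Φ p (n + 1) _)
  · refine congrArg _ ?_
    rw [diag_castSucc_dropLast, ← map_map_apply]
    exact (crossProj_map_crossProj Φ _ (diag_controls (𝟙 p.F) n i) _).symm

/-- The embedding `Φ(F|...|F|R) → N^n`. -/
def ofCrossRel (n : ℕ) :
    crossEffect Φ (mixed p.F p.R n) →ₗ[K] normalizedSubmodule (p.mapCosimplicial Φ) n :=
  ofNormalizedCoord Φ p (crossEffect Φ (mixed p.F p.R n)).subtype fun x i =>
    (mem_crossEffect Φ _ x.1).1 x.2 (some i)

/-- The embedding `Φ(F|...|F|F) → N^(n+1)`. -/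
def ofCrossFree (n : ℕ) :
    crossEffect Φ (mixed p.F p.F n) →ₗ[K] normalizedSubmodule (p.mapCosimplicial Φ) (n + 1) :=
  ofNormalizedCoord Φ p ((Φ.map (addLast p.F p.R n)).hom ∘ₗ
      (crossEffect Φ (mixed p.F p.F n)).subtype) fun x i => by
    rw [LinearMap.comp_apply, map_map_apply]
    have hx := (mem_crossEffect Φ _ x.1).1 x.2
    refine map_eq_zero_of_map_pr_eq_zero Φ _
      -- The position in F^n ⊕ F of the `i`-th copy of F in F^(n+1).
      (if h : (i : ℕ) < n then some ⟨i, h⟩ else none) (fun y z hyz => ?_) (hx _)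
    funext ⟨o, ho⟩
    change (addLast p.F p.R n).hom y o = (addLast p.F p.R n).hom z o
    cases o with
    | none => rfl
    | some k =>
      rw [addLast_some, addLast_some]
      have hki : (k : ℕ) ≠ i := fun e => ho (by rw [Fin.ext e])
      unfold extSeq
      split_ifs with h
      · refine hyz _ ?_
        split_ifs <;> simp [Fin.ext_iff, hki]
      · refine congrArg _ (hyz _ ?_)
        rw [dif_pos (by omega)]
        simp

theorem toCrossRel_ofCrossRel (n : ℕ) (x : crossEffect Φ (mixed p.F p.R n)) :
    toCrossRel Φ p n (ofCrossRel Φ p n x) = x :=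
  (congrArg (crossProj Φ _) (normalizedCoord_ofNormalizedCoord Φ p _ _ x)).trans
    (crossProj_of_mem Φ _ x)

theorem toCrossFree_ofCrossFree (n : ℕ) (x : crossEffect Φ (mixed p.F p.F n)) :
    toCrossFree Φ p n (ofCrossFree Φ p n x) = x := by
  refine (congrArg (fun z => crossProj Φ _ ((Φ.map (dropLast p.F p.R n)).hom z))
    (normalizedCoord_ofNormalizedCoord Φ p _ _ x)).trans ?_
  rw [LinearMap.comp_apply, map_map_apply, addLast_dropLast, Φ.map_id]
  exact crossProj_of_mem Φ _ x

theorem toCrossFree_ofCrossRel (n : ℕ) (x : crossEffect Φ (mixed p.F p.R (n + 1))) :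
    toCrossFree Φ p n (ofCrossRel Φ p (n + 1) x) = 0 := by
  refine (congrArg (fun z => crossProj Φ _ ((Φ.map (dropLast p.F p.R n)).hom z))
    (normalizedCoord_ofNormalizedCoord Φ p _ _ x)).trans ?_
  refine (congrArg _ ?_).trans (map_zero _)
  -- `dropLast` does not see the R-coordinate, and elements of Φ(F|...|F|R) vanish when R is
  -- forgotten.
  refine map_eq_zero_of_map_pr_eq_zero Φ _ none (fun y z hyz => ?_)
    ((mem_crossEffect Φ _ x.1).1 x.2 none)
  funext o
  cases o <;> exact hyz _ (by simp)

theorem toCrossRel_ofCrossFree (n : ℕ) (x : crossEffect Φ (mixed p.F p.F n)) :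
    toCrossRel Φ p (n + 1) (ofCrossFree Φ p n x) = 0 :=
  (congrArg (crossProj Φ _) (normalizedCoord_ofNormalizedCoord Φ p _ _ x)).trans
    (crossProj_map_eq_zero Φ _ none (fun _ => rfl) x.1)

/-- In degree 0 the cross effect is the kernel of Φ(R) → Φ(0), which is all of Φ(R) because Φ(0) =
0. -/
theorem ofCrossRel_toCrossRel_zero (hΦ : IsZero (Φ.obj (ModuleCat.of K PUnit.{v + 1})))
    (x : normalizedSubmodule (p.mapCosimplicial Φ) 0) :
    ofCrossRel Φ p 0 (toCrossRel Φ p 0 x) = x := by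
  apply normalizedCoord_injective Φ p 0
  refine (normalizedCoord_ofNormalizedCoord Φ p _ _ _).trans ?_
  have hz : normalizedCoord Φ p 0 x ∈ crossEffect Φ (mixed p.F p.R 0) := by
    rw [mem_crossEffect]
    intro j
    have : IsEmpty {i : Option (Fin 0) // i ≠ j} :=
      ⟨fun i => i.2 (Subsingleton.elim _ _)⟩
    have e : dsum (fun i : {i : Option (Fin 0) // i ≠ j} => mixed p.F p.R 0 i.1) ≅
        ModuleCat.of K PUnit.{v + 1} :=
      IsZero.iso (ModuleCat.isZero_of_subsingleton _) (ModuleCat.isZero_of_subsingleton _)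
    have h0 := hΦ.of_iso (Φ.mapIso e)
    exact @Subsingleton.elim _ (ModuleCat.subsingleton_of_isZero h0) _ _
  exact congrArg Subtype.val (crossProj_of_mem Φ _ ⟨_, hz⟩)

/-- Let e be the idempotent of F^(n+1) ⊕ R that kills R. Then z = (z - Φ(e)z) + Φ(e)z, and since z
vanishes when any copy of F is forgotten, the first term lies in Φ(F|...|F|R) and the second comes
from Φ(F|...|F). -/
theorem ofCrossRel_toCrossRel_add (n : ℕ)
    (x : normalizedSubmodule (p.mapCosimplicial Φ) (n + 1)) :
    ofCrossRel Φ p (n + 1) (toCrossRel Φ p (n + 1) x) +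
      ofCrossFree Φ p n (toCrossFree Φ p n x) = x := by
  apply normalizedCoord_injective Φ p (n + 1)
  rw [map_add]
  refine (congrArg₂ (· + ·) (normalizedCoord_ofNormalizedCoord Φ p _ _ _)
    (normalizedCoord_ofNormalizedCoord Φ p _ _ _)).trans ?_
  have hpr := pr_some_normalizedCoord Φ p (n + 1) x
  generalize hz : normalizedCoord Φ p (n + 1) x = z at hpr
  have hfree : (Φ.map (dropLast p.F p.R n)).hom z ∈ crossEffect Φ (mixed p.F p.F n) := by
    rw [mem_crossEffect]
    intro j
    rw [map_map_apply]
    refine map_eq_zero_of_map_pr_eq_zero Φ _ (some (match j with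
      | none => Fin.last n
      | some k => k.castSucc)) (fun y w hyw => ?_) (hpr _)
    funext ⟨o, ho⟩
    cases o with
    | none =>
      refine hyw (some (Fin.last n)) ?_
      cases j with
      | none => exact absurd rfl ho
      | some k => simpa using (Fin.castSucc_lt_last k).ne'
    | some l =>
      refine hyw (some l.castSucc) ?_
      cases j with
      | none => simp [Fin.ext_iff, l.2.ne]
      | some k => simpa using ho
  have hrel : z - (Φ.map (dropLast p.F p.R n ≫ addLast p.F p.R n)).hom z ∈
      crossEffect Φ (mixed p.F p.R (n + 1)) := by
    rw [mem_crossEffect]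
    intro j
    rw [map_sub, map_map_apply, sub_eq_zero]
    cases j with
    | none =>
      refine congrArg (fun f => (Φ.map f).hom z) (hom_dsum_ext fun y o => ?_)
      obtain ⟨o, ho⟩ := o
      cases o with
      | none => exact absurd rfl ho
      | some k => exact (dropLast_addLast_some n y k).symm
    | some i =>
      rw [hpr i]
      refine (map_eq_zero_of_map_pr_eq_zero Φ _ (some i) (fun y w hyw => ?_) (hpr i)).symm
      funext ⟨o, ho⟩
      cases o with
      | none => rfl
      | some k =>
        exact (dropLast_addLast_some n y k).trans
          ((hyw _ ho).trans (dropLast_addLast_some n w k).symm)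
  have h1 : (crossProj Φ (mixed p.F p.R (n + 1)) z).1 =
      z - (Φ.map (dropLast p.F p.R n ≫ addLast p.F p.R n)).hom z := by
    -- The projection fixes z - Φ(e)z and kills Φ(e)z, so its value at z is z - Φ(e)z.
    have h2 := crossProj_of_mem Φ _ ⟨_, hrel⟩
    rw [map_sub, crossProj_map_eq_zero Φ _ none (fun y => dropLast_addLast_none n y),
      sub_zero] at h2
    exact congrArg Subtype.val h2
  have h3 : (crossProj Φ (mixed p.F p.F n) ((Φ.map (dropLast p.F p.R n)).hom z)).1 =
      (Φ.map (dropLast p.F p.R n)).hom z :=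
    congrArg Subtype.val (crossProj_of_mem Φ _ ⟨_, hfree⟩)
  change (crossProj Φ (mixed p.F p.R (n + 1)) (normalizedCoord Φ p (n + 1) x)).1 +
    (Φ.map (addLast p.F p.R n)).hom (crossProj Φ (mixed p.F p.F n)
      ((Φ.map (dropLast p.F p.R n)).hom (normalizedCoord Φ p (n + 1) x))).1 = z
  rw [hz, h1, h3, map_map_apply, sub_add_cancel]

variable {Φ p} {Φ' : ModuleCat.{v} K ⥤ ModuleCat.{v} K} {p' : Pres A'}

/-- The map of cosimplicial modules induced by a natural transformation and a square. -/
abbrev Square.mapCosimplicial (τ : Φ ⟶ Φ') (s : Square p p') :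
    p.mapCosimplicial Φ ⟶ p'.mapCosimplicial Φ' :=
  ((CosimplicialObject.whiskering _ _).obj Φ).map s.relCopowers ≫ Functor.whiskerLeft _ τ

theorem normalizedCoord_natural (τ : Φ ⟶ Φ') (s : Square p p') (n : ℕ)
    (x : normalizedSubmodule (p.mapCosimplicial Φ) n) :
    normalizedCoord Φ' p' n ((normalizedMapX (s.mapCosimplicial τ) n).hom x) =
      (Φ.map (dsumMap (mixedMap s.rel s.top n)) ≫ τ.app _).hom (normalizedCoord Φ p n x) := by
  have h : (Φ.map (s.pow n).rel ≫ τ.app _) ≫ Φ'.map (p'.relCoord n) =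
      Φ.map (p.relCoord n) ≫ Φ.map (dsumMap (mixedMap s.rel s.top n)) ≫ τ.app _ := by
    rw [Category.assoc, ← τ.naturality, ← Functor.map_comp_assoc, ← Functor.map_comp_assoc,
      s.pow_rel_relCoord]
  exact congrArg (fun f => f.hom x.1) h

theorem toCrossRel_natural (τ : Φ ⟶ Φ') (s : Square p p') (n : ℕ)
    (x : normalizedSubmodule (p.mapCosimplicial Φ) n) :
    toCrossRel Φ' p' n ((normalizedMapX (s.mapCosimplicial τ) n).hom x) =
      crossEffectMap τ (mixedMap s.rel s.top n) (toCrossRel Φ p n x) :=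
  (congrArg _ (normalizedCoord_natural τ s n x)).trans (crossProj_natural τ _ _)

theorem toCrossFree_natural (τ : Φ ⟶ Φ') (s : Square p p') (n : ℕ)
    (x : normalizedSubmodule (p.mapCosimplicial Φ) (n + 1)) :
    toCrossFree Φ' p' n ((normalizedMapX (s.mapCosimplicial τ) (n + 1)).hom x) =
      crossEffectMap τ (mixedMap s.top s.top n) (toCrossFree Φ p n x) := by
  refine (congrArg (fun z => crossProj Φ' _ ((Φ'.map (dropLast p'.F p'.R n)).hom z))
    (normalizedCoord_natural τ s (n + 1) x)).trans (Eq.trans (congrArg _ ?_)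
    (crossProj_natural τ _ _))
  have h : (Φ.map (dsumMap (mixedMap s.rel s.top (n + 1))) ≫ τ.app _) ≫
      Φ'.map (dropLast p'.F p'.R n) = Φ.map (dropLast p.F p.R n) ≫
        Φ.map (dsumMap (mixedMap s.top s.top n)) ≫ τ.app _ := by
    rw [Category.assoc, ← τ.naturality, ← Functor.map_comp_assoc, ← Functor.map_comp_assoc,
      dropLast_natural]
  exact congrArg (fun f => f.hom (normalizedCoord Φ p (n + 1) x)) h

end Components

/-! ### The isomorphism with the shifted cone -/

section Comparison

open Simplicial ComplexShape

variable {A A' : ModuleCat.{v} K} (Φ : ModuleCat.{v} K ⥤ ModuleCat.{v} K) (p : Pres A)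

theorem neg_one_pow_smul_smul {M : Type*} [AddCommGroup M] (n : ℕ) (x : M) :
    (-1 : ℤ) ^ n • (-1 : ℤ) ^ n • x = x := by
  rw [smul_smul, ← mul_pow, neg_one_mul, neg_neg, one_pow, one_smul]

/-- The chain map `Lim_{(p)} (Φ R_A) → C_Φ(φ_p)`, with the sign `(-1)^n` in degree `n`. -/
def limToCrossComplex : limComplex Φ p ⟶ crossComplex Φ p.φ :=
  CochainComplex.ofHom (fun n => ModuleCat.ofHom ((-1 : ℤ) ^ n • toCrossRel Φ p n)) (fun n => by
    simp only [limComplex, standardComplex, normalizedComplex, crossComplex, CochainComplex.of_d]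
    apply ModuleCat.hom_ext
    apply LinearMap.ext
    intro x
    change (crossD Φ p.φ n).hom ((-1 : ℤ) ^ n • toCrossRel Φ p n x) =
      (-1 : ℤ) ^ (n + 1) • toCrossRel Φ p (n + 1) ((normalizedD (p.mapCosimplicial Φ) n).hom x)
    rw [toCrossRel_normalizedD, map_zsmul, pow_succ, mul_neg_one, neg_smul_neg])

/-- The maps `Lim_{(p)} (Φ R_A)^(n+1) → C_Φ(F)^n`. -/
def limToCrossFree (n : ℕ) :
    (limComplex Φ p).X (n + 1) ⟶ (crossComplex Φ (𝟙 p.F)).X n :=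
  ModuleCat.ofHom (toCrossFree Φ p n)

theorem limComplex_d (n : ℕ) :
    (limComplex Φ p).d n (n + 1) = normalizedD (p.mapCosimplicial Φ) n := by
  simp only [limComplex, standardComplex, normalizedComplex, CochainComplex.of_d]

theorem crossComplex_d {B C : ModuleCat.{v} K} (φ : B ⟶ C) (n : ℕ) :
    (crossComplex Φ φ).d n (n + 1) = crossD Φ φ n := by
  simp only [crossComplex, CochainComplex.of_d]

theorem limToCrossFree_zero :
    (limComplex Φ p).d 0 1 ≫ limToCrossFree Φ p 0 = -((limToCrossComplex Φ p).f 0 ≫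
      (crossComplexMap (𝟙 Φ) p.φ (𝟙 p.F) rfl).f 0) := by
  rw [limComplex_d]
  apply ModuleCat.hom_ext
  apply LinearMap.ext
  intro x
  refine (toCrossFree_normalizedD_zero Φ p x).trans ?_
  change _ = -crossEffectMap (𝟙 Φ) (mixedMap p.φ (𝟙 p.F) 0) ((1 : ℤ) • toCrossRel Φ p 0 x)
  rw [one_smul]

/-- The sign of the last coface is exactly the one built into `limToCrossComplex`, so no sign
remains in front of C_Φ(1_F, φ_p). -/
theorem limToCrossFree_succ (n : ℕ) :
    (limComplex Φ p).d (n + 1) (n + 2) ≫ limToCrossFree Φ p (n + 1) =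
      -((limToCrossComplex Φ p).f (n + 1) ≫
        (crossComplexMap (𝟙 Φ) p.φ (𝟙 p.F) rfl).f (n + 1)) -
        limToCrossFree Φ p n ≫ (crossComplex Φ (𝟙 p.F)).d n (n + 1) := by
  rw [limComplex_d, crossComplex_d]
  apply ModuleCat.hom_ext
  apply LinearMap.ext
  intro x
  refine (toCrossFree_normalizedD_succ Φ p n x).trans ?_
  rw [← map_zsmul]
  rfl

/-- The comparison map from `Lim_{(p)} (Φ R_A)` to the shifted cone. -/
def limToShiftedCone : (limComplex Φ p).extend embeddingUpNat ⟶ shiftedCone Φ p :=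
  coneLift (coneInput Φ p)
    (HomologicalComplex.extendMap (limToCrossComplex Φ p) embeddingUpNat)
    (extendCochain (limToCrossFree Φ p))
    (extendCochain_homotopy _ _ _ (limToCrossFree_zero Φ p) (limToCrossFree_succ Φ p))

theorem isIso_limToShiftedCone (hΦ : IsZero (Φ.obj (ModuleCat.of K PUnit.{v + 1}))) :
    IsIso (limToShiftedCone Φ p) := by
  refine isIso_coneLift_extend _ _ _ (limToCrossFree_zero Φ p) (limToCrossFree_succ Φ p)
    -- The sign (-1)^n is its own inverse, so the embedding carries the same sign as the projection.
    (fun n => ModuleCat.ofHom ((-1 : ℤ) ^ n • ofCrossRel Φ p n))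
    (fun n => ModuleCat.ofHom (ofCrossFree Φ p n)) (fun n => ?_) (fun n => ?_) (fun n => ?_)
    (fun n => ?_) ?_ (fun n => ?_)
  all_goals
    apply ModuleCat.hom_ext
    apply LinearMap.ext
    intro x
  · change (-1 : ℤ) ^ n • toCrossRel Φ p n ((-1 : ℤ) ^ n • ofCrossRel Φ p n x) = x
    rw [map_zsmul, neg_one_pow_smul_smul]
    exact toCrossRel_ofCrossRel Φ p n x
  · exact toCrossFree_ofCrossFree Φ p n x
  · change toCrossFree Φ p n ((-1 : ℤ) ^ (n + 1) • ofCrossRel Φ p (n + 1) x) = 0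
    rw [map_zsmul]
    exact (congrArg _ (toCrossFree_ofCrossRel Φ p n x)).trans (smul_zero _)
  · change (-1 : ℤ) ^ (n + 1) • toCrossRel Φ p (n + 1) (ofCrossFree Φ p n x) = 0
    exact (congrArg _ (toCrossRel_ofCrossFree Φ p n x)).trans (smul_zero _)
  · change (-1 : ℤ) ^ 0 • ofCrossRel Φ p 0 ((-1 : ℤ) ^ 0 • toCrossRel Φ p 0 x) = x
    rw [map_zsmul, neg_one_pow_smul_smul]
    exact ofCrossRel_toCrossRel_zero Φ p hΦ x
  · change (-1 : ℤ) ^ (n + 1) • ofCrossRel Φ p (n + 1)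
      ((-1 : ℤ) ^ (n + 1) • toCrossRel Φ p (n + 1) x) +
        ofCrossFree Φ p n (toCrossFree Φ p n x) = x
    rw [map_zsmul, neg_one_pow_smul_smul]
    exact ofCrossRel_toCrossRel_add Φ p n x

variable {Φ p} {Φ' : ModuleCat.{v} K ⥤ ModuleCat.{v} K} {p' : Pres A'}

theorem limToShiftedCone_natural (τ : Φ ⟶ Φ') (s : Square p p') :
    HomologicalComplex.extendMap (limComplexMap τ s) embeddingUpNat ≫ limToShiftedCone Φ' p' =
      limToShiftedCone Φ p ≫ shiftedConeMap τ s := by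
  refine coneLift_naturality _ _ _ (coneInput_natural τ s) ?_
    (extendCochain_naturality _ _ fun n => ?_)
  · rw [← HomologicalComplex.extendMap_comp, ← HomologicalComplex.extendMap_comp]
    congr 1
    ext n x
    change (-1 : ℤ) ^ n • toCrossRel Φ' p' n ((normalizedMapX (s.mapCosimplicial τ) n).hom x) =
      crossEffectMap τ (mixedMap s.rel s.top n) ((-1 : ℤ) ^ n • toCrossRel Φ p n x)
    rw [map_zsmul]
    exact congrArg _ (toCrossRel_natural τ s n x)
  · apply ModuleCat.hom_ext
    apply LinearMap.ext
    intro x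
    exact toCrossFree_natural τ s n x

end Comparison

end

end CrossEffectComplex

theorem mainTheorem4 {K : Type u} [CommRing K] :
    ∃ e : ∀ (Φ : ModuleCat.{v} K ⥤ ModuleCat.{v} K)
        (_ : IsZero (Φ.obj (ModuleCat.of K PUnit.{v + 1})))
        (A : ModuleCat.{v} K) (p : CrossEffectComplex.Pres A),
        (CrossEffectComplex.limComplex Φ p).extend ComplexShape.embeddingUpNat ≅
          CrossEffectComplex.shiftedCone Φ p,
      ∀ (Φ Φ' : ModuleCat.{v} K ⥤ ModuleCat.{v} K)
        (hΦ : IsZero (Φ.obj (ModuleCat.of K PUnit.{v + 1})))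
        (hΦ' : IsZero (Φ'.obj (ModuleCat.of K PUnit.{v + 1})))
        (τ : Φ ⟶ Φ') (A A' : ModuleCat.{v} K)
        (p : CrossEffectComplex.Pres A) (p' : CrossEffectComplex.Pres A')
        (s : CrossEffectComplex.Square p p'),
        HomologicalComplex.extendMap (CrossEffectComplex.limComplexMap τ s)
            ComplexShape.embeddingUpNat ≫ (e Φ' hΦ' A' p').hom =
          (e Φ hΦ A p).hom ≫ CrossEffectComplex.shiftedConeMap τ s := by
  exact ⟨fun Φ hΦ _ p => @asIso _ _ _ _ (CrossEffectComplex.limToShiftedCone Φ p)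
      (CrossEffectComplex.isIso_limToShiftedCone Φ p hΦ),
    fun _ _ _ _ τ _ _ _ _ s => CrossEffectComplex.limToShiftedCone_natural τ s⟩
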